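/- Let $d\ge 0$ be an integer and let $(X,\mu)$ be a $\sigma$-finite non-atomic standard Borel measure space with $\mu(X)=\infty$. Let $\mathrm{Aut}(X,\mu)$ be the group of invertible $\mu$-preserving Borel transformations of $X$ (two of them being identified if they agree $\mu$-almost everywhere), with the weak topology, in which $S_n\to S$ if and only if $\mu(S_nB\,\triangle\, SB)\to 0$ for every measurable $B$ with $\mu(B)<\infty$. Let $\mathcal A_\mu^{\mathbb Z^d}$ be the space of all $\mu$-preserving actions $T=(T_\gamma)_{\gamma\in\mathbb Z^d}$ of $\mathbb Z^d$ on $(X,\mu)$, that is, of all homomorphisms $\gamma\mapsto T_\gamma$ from $\mathbb Z^d$ to $\mathrm{Aut}(X,\mu)$, with the compact-open topology. Let $P(\mathbb R^d)$ be the set of lines through the origin (1-dimensional linear subspaces) of the Euclidean space $\mathbb R^d\supset\mathbb Z^d$. An action $T$ is called recurrent along a line $\theta\in P(\mathbb R^d)$ if for every $\epsilon>0$ and every measurable $A\subset X$ with $\mu(A)>0$ there are $\gamma\in\mathbb Z^d\setminus\{0\}$ and $g\in\theta$ such that $\mathrm{dist}(\gamma,g)<\epsilon$ and $\mu(A\cap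 T_\gamma A)>0$. Let $\mathcal R(T)\subset P(\mathbb R^d)$ be the set of all lines along which $T$ is recurrent. Then $\mathcal A_\mu^{\mathbb Z^d}$ is a Polish space, and the set $$\{T\in\mathcal A_\mu^{\mathbb Z^d} : \mathcal R(T)=P(\mathbb R^d)\}$$ of the actions that are recurrent in every direction is residual in it. -/

import Mathlib

open MeasureTheory Set Topology
open scoped ENNReal LinearAlgebra.Projectivization

noncomputable section

namespace DirRec

/-- The group of all invertible transformations of `X` that are measurable together with their
inverse and preserve `μ` (as point maps, before identification modulo null sets). -/
def invertibleMP {X : Type*} [MeasurableSpace X] (μ : Measure X) : Subgroup (Equiv.Perm X) where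
  carrier := {e | MeasurePreserving e μ μ ∧ MeasurePreserving e.symm μ μ}
  one_mem' := ⟨MeasurePreserving.id μ, MeasurePreserving.id μ⟩
  mul_mem' {_ _} ha hb := ⟨ha.1.comp hb.1, hb.2.comp ha.2⟩
  inv_mem' {_} ha := ⟨ha.2, ha.1⟩

/-- The subgroup of the transformations that are equal to the identity almost everywhere. -/
def aeTrivial {X : Type*} [MeasurableSpace X] (μ : Measure X) : Subgroup (invertibleMP μ) where
  carrier := {e | ∀ᵐ x ∂μ, (e : Equiv.Perm X) x = x}
  one_mem' := show ∀ᵐ x ∂μ, ((1 : invertibleMP μ) : Equiv.Perm X) x = x from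
    Filter.Eventually.of_forall fun _ => rfl
  mul_mem' {a b} ha hb := by
    simp only [mem_ofPred_eq] at ha hb ⊢
    filter_upwards [ha, hb] with x hxa hxb
    simp [hxa, hxb]
  inv_mem' {a} ha := by
    simp only [mem_ofPred_eq] at ha ⊢
    filter_upwards [ha] with x hx
    exact (Equiv.symm_apply_eq _).mpr hx.symm

instance aeTrivial_normal {X : Type*} [MeasurableSpace X] (μ : Measure X) :
    (aeTrivial μ).Normal where
  conj_mem n hn g := by
    have hn' : ∀ᵐ x ∂μ, (n : Equiv.Perm X) x = x := hn
    change ∀ᵐ x ∂μ, ((g * n * g⁻¹ : invertibleMP μ) : Equiv.Perm X) x = x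
    have h := g.2.2.quasiMeasurePreserving.ae hn'
    filter_upwards [h] with x hx
    change (g : Equiv.Perm X) ((n : Equiv.Perm X) ((g : Equiv.Perm X).symm x)) = x
    rw [hx, Equiv.apply_symm_apply]

/-- `Aut(X, μ)`: the group of invertible `μ`-preserving transformations of `X`, two
transformations being identified when they are equal almost everywhere. -/
def Aut {X : Type*} [MeasurableSpace X] (μ : Measure X) : Type _ :=
  invertibleMP μ ⧸ aeTrivial μ

instance Aut.instGroup {X : Type*} [MeasurableSpace X] (μ : Measure X) : Group (Aut μ) :=
  inferInstanceAs (Group (invertibleMP μ ⧸ aeTrivial μ))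

/-- Transformations with the same class in `Aut(X, μ)` have the same images modulo null sets. -/
theorem image_ae_eq {X : Type*} [MeasurableSpace X] {μ : Measure X} {e f : invertibleMP μ}
    (h : QuotientGroup.leftRel (aeTrivial μ) e f) (A : Set X) :
    ((e : Equiv.Perm X) '' A : Set X) =ᵐ[μ] ((f : Equiv.Perm X) '' A : Set X) := by
  have h1 : ∀ᵐ x ∂μ, ((e⁻¹ * f : invertibleMP μ) : Equiv.Perm X) x = x :=
    QuotientGroup.leftRel_apply.mp h
  have h2 : ∀ᵐ x ∂μ, (e : Equiv.Perm X).symm ((f : Equiv.Perm X) x) = x := h1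
  have h3 := f.2.2.quasiMeasurePreserving.ae h2
  rw [Equiv.image_eq_preimage_symm, Equiv.image_eq_preimage_symm]
  filter_upwards [h3] with x hx
  rw [Equiv.apply_symm_apply] at hx
  change ((e : Equiv.Perm X).symm x ∈ A) = ((f : Equiv.Perm X).symm x ∈ A)
  rw [hx]

/-- `μ(A ∩ T B)` for `T ∈ Aut(X, μ)`. -/
def Aut.interMeasure {X : Type*} [MeasurableSpace X] {μ : Measure X} (T : Aut μ) (A B : Set X) :
    ℝ≥0∞ :=
  Quotient.liftOn T (fun e : invertibleMP μ => μ (A ∩ (e : Equiv.Perm X) '' B))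
    fun _ _ h => measure_congr (ae_eq_set_inter (ae_eq_refl A) (image_ae_eq h B))

/-- `μ(A ∆ T B)` for `T ∈ Aut(X, μ)`. -/
def Aut.symmDiffMeasure {X : Type*} [MeasurableSpace X] {μ : Measure X} (T : Aut μ)
    (A B : Set X) : ℝ≥0∞ :=
  Quotient.liftOn T (fun e : invertibleMP μ => μ (symmDiff A ((e : Equiv.Perm X) '' B)))
    fun _ _ h => measure_congr (ae_eq_set_symmDiff (ae_eq_refl A) (image_ae_eq h B))

/-- The measurable sets of finite measure. -/
def FiniteSets {X : Type*} [MeasurableSpace X] (μ : Measure X) : Type _ :=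
  {A : Set X // MeasurableSet A ∧ μ A < ∞}

/-- The weak topology on `Aut(X, μ)`: the coarsest topology that makes all maps `T ↦ T B`
continuous, for `B` of finite measure, where the sets of finite measure carry the pseudometric
`(A, B) ↦ μ(A ∆ B)`. So `Tₙ → T` if and only if `μ(T B ∆ Tₙ B) → 0` for all such `B`. -/
instance Aut.instTopologicalSpace {X : Type*} [MeasurableSpace X] (μ : Measure X) :
    TopologicalSpace (Aut μ) :=
  TopologicalSpace.induced
    (fun (T : Aut μ) (p : FiniteSets μ × FiniteSets μ) => T.symmDiffMeasure p.1.1 p.2.1)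
    inferInstance

/-- The space of all `μ`-preserving actions of `ℤ^d` on `(X, μ)`, i.e. of all continuous
homomorphisms from (the discrete group) `ℤ^d` to `Aut(X, μ)`. As a space of continuous
homomorphisms it carries the compact-open topology. -/
abbrev ZdAction (d : ℕ) {X : Type*} [MeasurableSpace X] (μ : Measure X) : Type _ :=
  Multiplicative (Fin d → ℤ) →ₜ* Aut μ

/-- The transformation `T_γ`. -/
def ZdAction.transf {d : ℕ} {X : Type*} [MeasurableSpace X] {μ : Measure X} (T : ZdAction d μ)
    (γ : Fin d → ℤ) : Aut μ :=
  T (Multiplicative.ofAdd γ)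

/-- The inclusion of the lattice `ℤ^d` in the Euclidean space `ℝ^d`. -/
def latticePoint {d : ℕ} (γ : Fin d → ℤ) : EuclideanSpace ℝ (Fin d) :=
  WithLp.toLp 2 fun i => (γ i : ℝ)

/-- `T` is recurrent along the line `θ ∈ P(ℝ^d)`: for all `ε > 0` and all measurable `A` of
positive measure there are `γ ∈ ℤ^d`, `γ ≠ 0`, and `g ∈ θ` with `dist(γ, g) < ε` and
`μ(A ∩ T_γ A) > 0`. -/
def RecurrentAlong {d : ℕ} {X : Type*} [MeasurableSpace X] {μ : Measure X} (T : ZdAction d μ)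
    (θ : ℙ ℝ (EuclideanSpace ℝ (Fin d))) : Prop :=
  ∀ ε : ℝ, 0 < ε → ∀ A : Set X, MeasurableSet A → 0 < μ A →
    ∃ γ : Fin d → ℤ, γ ≠ 0 ∧ ∃ g ∈ θ.submodule,
      dist (latticePoint γ) g < ε ∧ 0 < (T.transf γ).interMeasure A A

/-- The set of all recurrent directions of `T`. -/
def recurrentDirections {d : ℕ} {X : Type*} [MeasurableSpace X] {μ : Measure X}
    (T : ZdAction d μ) : Set (ℙ ℝ (EuclideanSpace ℝ (Fin d))) :=
  {θ | RecurrentAlong T θ}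

end DirRec

end

/-! Residuality is a Baire category argument. Fix `B` from a countable dense family of sets of
finite positive measure, and `ε = 1/(m+1)`. Ask for a finite set `Γ` of nonzero lattice points that
comes `ε`-close to every line and whose elements all move `B` by less than `μ B / 4`. Finiteness of
`Γ` handles the uncountably many lines at once and makes the condition open (`isOpen_nearlyRigid`).
An action that satisfies all these countably many conditions is recurrent in every direction, by
approximating a given set by some `B` (`measure_inter_img_pos`).

For density, an action that factors through `(ℤ/N)^d` fixes every set under `N ℤ^d`, and Dirichlet's
pigeonhole argument finds `Γ` inside `N ℤ^d` (`exists_finset_near_lines`). Such actions approximate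
any `T` (`exists_periodic_tendsto`): identify `X` with `(ℤ/N)^d × X` without disturbing finitely
many given sets, and let `γ` translate the base and act on the fibre over `y` by `T` at the
coboundary `[y + γ] - [y]`. This equals `γ` unless a coordinate wraps around, which happens for a
proportion `O(|γ|/N)` of the `y`.

Polishness: the indicators of the images of a dense sequence of sets under `T` and `T⁻¹` embed `Aut
μ` as a closed subset of a countable power of `L¹` (`Aut.isClosedEmbedding_indicators`), and actions
form a closed subset of a countable power of `Aut μ`. -/

noncomputable section

namespace DirRec

open Filter

/-! ### Point representatives and images of sets modulo null sets. -/

section AutBasics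

variable {X : Type*} [MeasurableSpace X] {μ : Measure X}

theorem measure_symmDiff_congr {A A' B B' : Set X} (hA : A =ᵐ[μ] A') (hB : B =ᵐ[μ] B') :
    μ (symmDiff A B) = μ (symmDiff A' B') :=
  measure_congr (ae_eq_set_symmDiff hA hB)

/-- The class of an invertible transformation in `Aut(X, μ)`. -/
def Aut.mk (e : invertibleMP μ) : Aut μ :=
  (QuotientGroup.mk e : invertibleMP μ ⧸ aeTrivial μ)

/-- A representative of an element of `Aut(X, μ)`. -/
def Aut.out (T : Aut μ) : invertibleMP μ :=
  Quotient.out (s := QuotientGroup.leftRel (aeTrivial μ)) T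

/-- A point map that represents an element of `Aut(X, μ)`. -/
def Aut.rep (T : Aut μ) : Equiv.Perm X := (Aut.out T : Equiv.Perm X)

theorem Aut.mk_out (T : Aut μ) : Aut.mk T.out = T :=
  Quotient.out_eq (s := QuotientGroup.leftRel (aeTrivial μ)) T

theorem Aut.mk_mul (e f : invertibleMP μ) : Aut.mk (e * f) = Aut.mk e * Aut.mk f := rfl

theorem Aut.mk_inv (e : invertibleMP μ) : Aut.mk e⁻¹ = (Aut.mk e)⁻¹ := rfl

theorem Aut.mk_eq_mk {e f : invertibleMP μ} :
    Aut.mk e = Aut.mk f ↔ ((e : Equiv.Perm X) : X → X) =ᵐ[μ] (f : Equiv.Perm X) := by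
  have h0 : Aut.mk e = Aut.mk f ↔ e⁻¹ * f ∈ aeTrivial μ := QuotientGroup.eq
  have h1 : e⁻¹ * f ∈ aeTrivial μ ↔
      ∀ᵐ x ∂μ, (e : Equiv.Perm X).symm ((f : Equiv.Perm X) x) = x := Iff.rfl
  rw [h0, h1]
  refine eventually_congr (Eventually.of_forall fun x => ?_)
  rw [Equiv.symm_apply_eq, eq_comm]

theorem Aut.rep_mp (T : Aut μ) : MeasurePreserving T.rep μ μ := T.out.2.1

theorem Aut.rep_symm_mp (T : Aut μ) : MeasurePreserving T.rep.symm μ μ := T.out.2.2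

theorem Aut.rep_mk (e : invertibleMP μ) :
    ((Aut.mk e).rep : X → X) =ᵐ[μ] (e : Equiv.Perm X) :=
  Aut.mk_eq_mk.mp (Aut.mk_out _)

theorem Aut.eq_iff {S T : Aut μ} : S = T ↔ (S.rep : X → X) =ᵐ[μ] T.rep := by
  conv_lhs => rw [← Aut.mk_out S, ← Aut.mk_out T]
  exact Aut.mk_eq_mk

theorem Aut.rep_mul (S T : Aut μ) : ((S * T).rep : X → X) =ᵐ[μ] S.rep ∘ T.rep := by
  have h : Aut.mk (S.out * T.out) = S * T := by rw [Aut.mk_mul, Aut.mk_out, Aut.mk_out]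
  rw [← h]
  exact Aut.rep_mk _

theorem Aut.rep_one : ((1 : Aut μ).rep : X → X) =ᵐ[μ] id := Aut.rep_mk 1

theorem Aut.rep_inv (T : Aut μ) : (T⁻¹.rep : X → X) =ᵐ[μ] T.rep.symm := by
  have h : Aut.mk (T.out⁻¹) = T⁻¹ := by rw [Aut.mk_inv, Aut.mk_out]
  rw [← h]
  exact Aut.rep_mk _

/-- The image of a set under (a representative of) an element of `Aut(X, μ)`. -/
def Aut.img (T : Aut μ) (B : Set X) : Set X := T.rep.symm ⁻¹' B

theorem Aut.measurableSet_img (T : Aut μ) {B : Set X} (hB : MeasurableSet B) :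
    MeasurableSet (T.img B) := T.rep_symm_mp.measurable hB

theorem Aut.measure_img (T : Aut μ) {B : Set X} (hB : MeasurableSet B) :
    μ (T.img B) = μ B := T.rep_symm_mp.measure_preimage hB.nullMeasurableSet

theorem Aut.symmDiffMeasure_eq (T : Aut μ) (A B : Set X) :
    T.symmDiffMeasure A B = μ (symmDiff A (T.img B)) := by
  conv_lhs => rw [← Aut.mk_out T]
  rw [Aut.img, ← Equiv.image_eq_preimage_symm]
  rfl

theorem Aut.interMeasure_eq (T : Aut μ) (A B : Set X) :
    T.interMeasure A B = μ (A ∩ T.img B) := by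
  conv_lhs => rw [← Aut.mk_out T]
  rw [Aut.img, ← Equiv.image_eq_preimage_symm]
  rfl

theorem ae_eq_symm_of_ae_eq {e f : Equiv.Perm X} (hf : MeasurePreserving f.symm μ μ)
    (h : (e : X → X) =ᵐ[μ] f) : (e.symm : X → X) =ᵐ[μ] f.symm := by
  filter_upwards [hf.quasiMeasurePreserving.ae h] with x hx
  rw [Equiv.symm_apply_eq, hx, Equiv.apply_symm_apply]

theorem Aut.img_mul (S T : Aut μ) (B : Set X) :
    (S * T).img B =ᵐ[μ] S.img (T.img B) := by
  have h := ae_eq_symm_of_ae_eq (e := (S * T).rep) (f := S.rep * T.rep)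
    (T.rep_symm_mp.comp S.rep_symm_mp) (Aut.rep_mul S T)
  filter_upwards [h] with x hx
  exact congrArg (· ∈ B) hx

theorem Aut.img_inv (T : Aut μ) (B : Set X) : T⁻¹.img B =ᵐ[μ] T.rep ⁻¹' B := by
  have h := ae_eq_symm_of_ae_eq (e := T⁻¹.rep) (f := T.rep.symm) T.rep_mp (Aut.rep_inv T)
  filter_upwards [h] with x hx
  exact congrArg (· ∈ B) hx

theorem Aut.img_one (B : Set X) : (1 : Aut μ).img B =ᵐ[μ] B := by
  have h := ae_eq_symm_of_ae_eq (e := (1 : Aut μ).rep) (f := 1) (MeasurePreserving.id μ)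
    Aut.rep_one
  filter_upwards [h] with x hx
  exact congrArg (· ∈ B) hx

theorem Aut.img_symmDiff (T : Aut μ) (A B : Set X) :
    T.img (symmDiff A B) = symmDiff (T.img A) (T.img B) := rfl

theorem Aut.measure_img_symmDiff (T : Aut μ) {A B : Set X} (hA : MeasurableSet A)
    (hB : MeasurableSet B) : μ (symmDiff (T.img A) (T.img B)) = μ (symmDiff A B) := by
  rw [← Aut.img_symmDiff, T.measure_img (hA.symmDiff hB)]

theorem Aut.measure_diff_img_inv (T : Aut μ) {A B : Set X} (hA : MeasurableSet A)
    (hB : MeasurableSet B) : μ (T⁻¹.img A \ B) = μ (A \ T.img B) := by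
  have h : μ (T⁻¹.img A \ B) = μ (T.rep ⁻¹' A \ B) :=
    measure_congr (ae_eq_set_sdiff (T.img_inv A) (ae_eq_refl B))
  rw [h, ← T.rep_symm_mp.measure_preimage
      ((T.rep_mp.measurable hA).diff hB).nullMeasurableSet]
  congr 1
  ext x
  simp [Aut.img]

theorem Aut.measure_symmDiff_img_inv (T : Aut μ) {A B : Set X} (hA : MeasurableSet A)
    (hB : MeasurableSet B) :
    μ (symmDiff A (T⁻¹.img B)) = μ (symmDiff (T.img A) B) := by
  rw [measure_symmDiff_congr (ae_eq_refl A) (T.img_inv B), ← T.rep_symm_mp.measure_preimage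
      (hA.symmDiff (T.rep_mp.measurable hB)).nullMeasurableSet]
  congr 1
  ext x
  simp [Aut.img, mem_symmDiff]

end AutBasics

/-! ### Convergence in the weak topology. -/

section Topology

variable {X : Type*} [MeasurableSpace X] {μ : Measure X}

theorem measure_symmDiff_triangle (A B C : Set X) :
    μ (symmDiff A C) ≤ μ (symmDiff A B) + μ (symmDiff B C) :=
  measure_symmDiff_le A B C

/-- The topology tests all pairs `(A, B)`. The choice `A = T B` gives one direction. For the other,
the triangle inequality squeezes `μ (A ∆ uᵢ B)` between `μ (A ∆ T B) ∓ μ (T B ∆ uᵢ B)`. -/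
theorem Aut.tendsto_iff {ι : Type*} {l : Filter ι} {u : ι → Aut μ} {T : Aut μ} :
    Tendsto u l (𝓝 T) ↔ ∀ B, MeasurableSet B → μ B ≠ ∞ →
      Tendsto (fun i => μ (symmDiff (T.img B) ((u i).img B))) l (𝓝 0) := by
  have hind : IsInducing (fun (T : Aut μ) (p : FiniteSets μ × FiniteSets μ) =>
      T.symmDiffMeasure p.1.1 p.2.1) := ⟨rfl⟩
  rw [hind.tendsto_nhds_iff, tendsto_pi_nhds]
  constructor
  · intro h B hB hBf
    have := h (⟨T.img B, T.measurableSet_img hB, (T.measure_img hB).trans_lt hBf.lt_top⟩,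
      ⟨B, hB, hBf.lt_top⟩)
    simpa [Function.comp_def, Aut.symmDiffMeasure_eq] using this
  · rintro h ⟨⟨A, hA, hAf⟩, ⟨B, hB, hBf⟩⟩
    have h0 := h B hB hBf.ne
    simp only [Function.comp_def, Aut.symmDiffMeasure_eq]
    have hfin : μ (symmDiff A (T.img B)) ≠ ∞ := by
      refine ne_top_of_le_ne_top ?_ (measure_mono symmDiff_subset_union)
      refine ne_top_of_le_ne_top ?_ (measure_union_le _ _)
      rw [T.measure_img hB]
      exact ENNReal.add_ne_top.2 ⟨hAf.ne, hBf.ne⟩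
    refine tendsto_of_tendsto_of_tendsto_of_le_of_le
      (g := fun i => μ (symmDiff A (T.img B)) - μ (symmDiff (T.img B) ((u i).img B)))
      (h := fun i => μ (symmDiff A (T.img B)) + μ (symmDiff (T.img B) ((u i).img B)))
      ?_ ?_ ?_ ?_
    · simpa using ENNReal.Tendsto.sub (tendsto_const_nhds (x := μ (symmDiff A (T.img B)))) h0
        (Or.inl hfin)
    · simpa using (tendsto_const_nhds (x := μ (symmDiff A (T.img B)))).add h0
    · intro i
      refine tsub_le_iff_right.2 ?_
      rw [symmDiff_comm (T.img B)]
      exact measure_symmDiff_triangle _ _ _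
    · intro i
      exact measure_symmDiff_triangle _ _ _

instance : ContinuousMul (Aut μ) where
  continuous_mul := by
    refine continuous_iff_continuousAt.2 fun p => ?_
    refine Aut.tendsto_iff.2 fun B hB hBf => ?_
    have h1 := Aut.tendsto_iff.1 (continuous_fst.tendsto p) (p.2.img B)
      (p.2.measurableSet_img hB) (by rwa [p.2.measure_img hB])
    have h2 := Aut.tendsto_iff.1 (continuous_snd.tendsto p) B hB hBf
    refine tendsto_of_tendsto_of_tendsto_of_le_of_le tendsto_const_nhds
      (by simpa using h1.add h2) (fun _ => zero_le) fun q => ?_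
    rw [measure_symmDiff_congr (Aut.img_mul p.1 p.2 B) (Aut.img_mul q.1 q.2 B)]
    -- The intermediate set separates the two variations, and `q.1` acts isometrically on the
    -- second.
    refine (measure_symmDiff_triangle _ (q.1.img (p.2.img B)) _).trans ?_
    rw [q.1.measure_img_symmDiff (p.2.measurableSet_img hB) (q.2.measurableSet_img hB)]

/-- A countable family of sets of finite measure that separates the points and is dense
in the measure algebra. -/
structure DenseSeparating (μ : Measure X) (A : ℕ → Set X) : Prop where
  meas : ∀ n, MeasurableSet (A n)
  fin : ∀ n, μ (A n) ≠ ∞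
  dense : ∀ B, MeasurableSet B → μ B ≠ ∞ → ∀ ε : ℝ≥0∞, ε ≠ 0 → ∃ n, μ (symmDiff B (A n)) < ε
  sep : ∀ x y, (∀ n, x ∈ A n ↔ y ∈ A n) → x = y
  cover : ⋃ n, A n = univ

/-- A measure-dense family need not separate points. Generators of the σ-algebra do, and
intersecting them with the spanning sets keeps the measures finite; the spanning sets themselves
provide the cover. -/
theorem exists_denseSeparating [StandardBorelSpace X] (μ : Measure X) [SigmaFinite μ] :
    ∃ A : ℕ → Set X, DenseSeparating μ A := by
  obtain ⟨𝒜, h𝒜c, h𝒜⟩ := exists_countable_measureDense (μ := μ)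
  let C : ℕ → Set X := MeasurableSpace.natGeneratingSequence X
  have hC : ∀ x y, (∀ n, x ∈ C n ↔ y ∈ C n) → x = y := fun x y h => by
    refine MeasurableSpace.injective_mapNatBool X (funext fun n => ?_)
    simpa [MeasurableSpace.mapNatBool] using h n
  let F : Set (Set X) := {s | s ∈ 𝒜 ∧ μ s ≠ ∞} ∪
    (range (spanningSets μ) ∪ range fun p : ℕ × ℕ => C p.1 ∩ spanningSets μ p.2)
  have hF : F.Countable :=
    (h𝒜c.mono fun s hs => hs.1).union ((countable_range _).union (countable_range _))
  have hne : F.Nonempty := ⟨_, Or.inr (Or.inl ⟨0, rfl⟩)⟩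
  obtain ⟨A, hA⟩ := hF.exists_eq_range hne
  have hmem : ∀ n, A n ∈ F := fun n => hA ▸ mem_range_self n
  have hsp : ∀ i, MeasurableSet (spanningSets μ i) ∧ μ (spanningSets μ i) ≠ ∞ := fun i =>
    ⟨measurableSet_spanningSets μ i, (measure_spanningSets_lt_top μ i).ne⟩
  refine ⟨A, ⟨fun n => ?_, fun n => ?_, fun B hB hBf ε hε => ?_, fun x y h => ?_, ?_⟩⟩
  · rcases hmem n with h | ⟨i, h⟩ | ⟨p, h⟩
    · exact h𝒜.measurable _ h.1
    · exact h ▸ (hsp i).1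
    · exact h ▸ (MeasurableSpace.measurableSet_natGeneratingSequence p.1).inter (hsp p.2).1
  · rcases hmem n with h | ⟨i, h⟩ | ⟨p, h⟩
    · exact h.2
    · exact h ▸ (hsp i).2
    · rw [← h]
      exact ne_top_of_le_ne_top (hsp p.2).2 (measure_mono inter_subset_right)
  · obtain ⟨δ, hδ, hδε⟩ := ENNReal.lt_iff_exists_nnreal_btwn.1 (pos_iff_ne_zero.2 hε)
    obtain ⟨t, ht, htf, htd⟩ := h𝒜.fin_meas_approx hB hBf δ (by simpa using hδ)
    have : t ∈ range A := hA ▸ Or.inl ⟨ht, htf⟩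
    obtain ⟨n, rfl⟩ := this
    exact ⟨n, htd.trans (by simpa using hδε)⟩
  · have h' : ∀ s ∈ F, x ∈ s ↔ y ∈ s := by
      intro s hs
      rw [hA] at hs
      obtain ⟨n, rfl⟩ := hs
      exact h n
    obtain ⟨i, hi⟩ := mem_iUnion.1 ((iUnion_spanningSets μ).symm ▸ mem_univ x)
    have hyi := (h' _ (Or.inr (Or.inl ⟨i, rfl⟩))).1 hi
    refine hC x y fun n => ?_
    have := h' _ (Or.inr (Or.inr ⟨(n, i), rfl⟩))
    simpa [hi, hyi] using this
  · refine eq_univ_of_forall fun x => ?_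
    obtain ⟨i, hi⟩ := mem_iUnion.1 ((iUnion_spanningSets μ).symm ▸ mem_univ x)
    have : spanningSets μ i ∈ range A := hA ▸ Or.inr (Or.inl ⟨i, rfl⟩)
    obtain ⟨n, hn⟩ := this
    exact mem_iUnion.2 ⟨n, hn ▸ hi⟩

theorem DenseSeparating.ae_eq {Y : Type*} [MeasurableSpace Y] {ν : Measure Y} {A : ℕ → Set X}
    (hA : DenseSeparating μ A) {f g : Y → X} (h : ∀ n, f ⁻¹' A n =ᵐ[ν] g ⁻¹' A n) :
    f =ᵐ[ν] g := by
  filter_upwards [ae_all_iff.2 h] with x hx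
  exact hA.sep _ _ fun n => (hx n).to_iff

theorem DenseSeparating.tendsto {A : ℕ → Set X} (hA : DenseSeparating μ A) {ι : Type*}
    {l : Filter ι} {u : ι → Aut μ} {T : Aut μ}
    (h : ∀ n, Tendsto (fun i => μ (symmDiff (T.img (A n)) ((u i).img (A n)))) l (𝓝 0)) :
    Tendsto u l (𝓝 T) := by
  refine Aut.tendsto_iff.2 fun B hB hBf => ?_
  refine ENNReal.tendsto_nhds_zero.2 fun ε hε => ?_
  have hε3 : ε / 3 ≠ 0 := (ENNReal.div_pos hε.ne' (by norm_num)).ne'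
  obtain ⟨n, hn⟩ := hA.dense B hB hBf (ε / 3) hε3
  filter_upwards [ENNReal.tendsto_nhds_zero.1 (h n) (ε / 3) (pos_iff_ne_zero.2 hε3)] with i hi
  calc μ (symmDiff (T.img B) ((u i).img B))
      ≤ μ (symmDiff (T.img B) (T.img (A n))) + μ (symmDiff (T.img (A n)) ((u i).img B)) :=
        measure_symmDiff_triangle _ _ _
    _ ≤ μ (symmDiff (T.img B) (T.img (A n))) + (μ (symmDiff (T.img (A n)) ((u i).img (A n)))
        + μ (symmDiff ((u i).img (A n)) ((u i).img B))) := by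
        gcongr
        exact measure_symmDiff_triangle _ _ _
    _ ≤ ε / 3 + (ε / 3 + ε / 3) := by
        rw [T.measure_img_symmDiff hB (hA.meas n), (u i).measure_img_symmDiff (hA.meas n) hB,
          symmDiff_comm (A n) B]
        gcongr
    _ = ε := by rw [← add_assoc, ENNReal.add_thirds]

end Topology

/-! ### Isomorphism of non-atomic standard Borel measure spaces. -/

section Isomorphism

variable {X : Type*} [MeasurableSpace X] {Z : Type*} [MeasurableSpace Z]

theorem not_countable_of_measure_ne_zero (μ : Measure X) [NullSingletonClass μ] (hμ : μ ≠ 0) :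
    ¬Countable X := fun _ =>
  hμ (Measure.measure_univ_eq_zero.1 ((Set.to_countable univ).measure_zero μ))

/-- Transport `X` to the plane. A σ-finite measure charges only countably many of the disjoint
vertical lines, so some line, which is uncountable, is null. -/
theorem exists_null_not_countable [StandardBorelSpace X] (μ : Measure X) [SigmaFinite μ]
    [NullSingletonClass μ] (hμ : μ ≠ 0) :
    ∃ N : Set X, MeasurableSet N ∧ μ N = 0 ∧ ¬N.Countable := by
  have hR : ¬Countable (ℝ × ℝ) := fun h =>
    not_countable (α := ℝ) (Function.Injective.countable (f := fun x : ℝ => (x, x))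
      fun x y h => (Prod.ext_iff.1 h).1)
  let e : X ≃ᵐ ℝ × ℝ :=
    PolishSpace.measurableEquivOfNotCountable (not_countable_of_measure_ne_zero μ hμ) hR
  have hm : ∀ t : ℝ, MeasurableSet (e ⁻¹' ({t} ×ˢ univ)) := fun t =>
    e.measurable ((measurableSet_singleton t).prod MeasurableSet.univ)
  have hc := Measure.countable_meas_pos_of_disjoint_iUnion (μ := μ) hm fun s t hst => by
    refine Disjoint.preimage _ (Set.disjoint_left.2 fun z hz hz' => hst ?_)
    exact (hz.1 : z.1 = s).symm.trans hz'.1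
  obtain ⟨t, ht⟩ : ∃ t, t ∉ {t : ℝ | 0 < μ (e ⁻¹' ({t} ×ˢ univ))} := by
    by_contra! h
    exact not_countable_univ (α := ℝ) (hc.mono fun t _ => h t)
  refine ⟨_, hm t, by simpa using ht, fun h => ?_⟩
  have h2 : (range fun s : ℝ => e.symm (t, s)).Countable :=
    h.mono (range_subset_iff.2 fun s => by simp)
  refine not_countable_univ (α := ℝ) (countable_of_injective_of_countable_image
    (f := fun s : ℝ => e.symm (t, s)) (s := univ) ?_ (by rwa [image_univ]))
  intro s _ s' _ h
  simpa using h

/-- A measure preserving map with a measurable almost everywhere left inverse agrees almost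
everywhere with a measurable equivalence. -/
theorem exists_measurableEquiv_ae_eq [StandardBorelSpace X] [StandardBorelSpace Z]
    {μ : Measure X} {ν : Measure Z} [SigmaFinite μ] [NullSingletonClass μ] [SigmaFinite ν]
    [NullSingletonClass ν] (hμ : μ ≠ 0) {f : X → Z} {g : Z → X} (hf : MeasurePreserving f μ ν)
    (hg : Measurable g) (hgf : ∀ᵐ x ∂μ, g (f x) = x) : ∃ e : X ≃ᵐ Z, e =ᵐ[μ] f := by
  classical
  have hν : ν ≠ 0 := fun h => hμ (Measure.measure_univ_eq_zero.1 (by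
    rw [← preimage_univ (f := f), hf.measure_preimage MeasurableSet.univ.nullMeasurableSet, h]
    simp))
  obtain ⟨N, hN, hN0, hNc⟩ := exists_null_not_countable μ hμ
  obtain ⟨M, hM, hM0, hMc⟩ := exists_null_not_countable ν hν
  -- `f` and `g` are mutually inverse between `E` and `F`. Discarding the uncountable null sets `N`
  -- and `M` makes both complements uncountable, hence Borel isomorphic, and the two bijections
  -- glue.
  let E : Set X := {x | g (f x) = x} ∩ (Nᶜ ∩ f ⁻¹' Mᶜ)
  let F : Set Z := {z | f (g z) = z} ∩ (Mᶜ ∩ g ⁻¹' Nᶜ)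
  have hE : MeasurableSet E := (measurableSet_eq_fun (hg.comp hf.measurable) measurable_id).inter
    (hN.compl.inter (hf.measurable hM.compl))
  have hF : MeasurableSet F := (measurableSet_eq_fun (hf.measurable.comp hg) measurable_id).inter
    (hM.compl.inter (hg hN.compl))
  have hEc : ¬(Eᶜ).Countable := fun h => hNc (h.mono (show N ⊆ Eᶜ from fun x hx hxE => hxE.2.1 hx))
  have hFc : ¬(Fᶜ).Countable := fun h => hMc (h.mono (show M ⊆ Fᶜ from fun x hx hxE => hxE.2.1 hx))
  have hEae : ∀ᵐ x ∂μ, x ∈ E := by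
    have h1 : ∀ᵐ x ∂μ, x ∉ N := measure_eq_zero_iff_ae_notMem.1 hN0
    have h2 : ∀ᵐ x ∂μ, f x ∉ M :=
      hf.quasiMeasurePreserving.ae (measure_eq_zero_iff_ae_notMem.1 hM0)
    filter_upwards [hgf, h1, h2] with x h3 h4 h5 using ⟨h3, h4, h5⟩
  have hEF : ∀ x ∈ E, f x ∈ F := fun x hx =>
    ⟨congrArg f hx.1, hx.2.2, by simpa [show g (f x) = x from hx.1] using hx.2.1⟩
  have hFE : ∀ z ∈ F, g z ∈ E := fun z hz =>
    ⟨congrArg g hz.1, hz.2.2, by simpa [show f (g z) = z from hz.1] using hz.2.1⟩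
  let e1 : E ≃ᵐ F :=
    { toFun := fun x => ⟨f x, hEF x x.2⟩
      invFun := fun z => ⟨g z, hFE z z.2⟩
      left_inv := fun x => Subtype.ext x.2.1
      right_inv := fun z => Subtype.ext z.2.1
      measurable_toFun := (hf.measurable.comp measurable_subtype_coe).subtype_mk
      measurable_invFun := (hg.comp measurable_subtype_coe).subtype_mk }
  have := hE.compl.standardBorel
  have := hF.compl.standardBorel
  let e2 : (Eᶜ : Set X) ≃ᵐ (Fᶜ : Set Z) := PolishSpace.measurableEquivOfNotCountable
    (by rwa [countable_coe_iff]) (by rwa [countable_coe_iff])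
  refine ⟨(MeasurableEquiv.sumCompl hE).symm.trans
    ((MeasurableEquiv.sumCongr e1 e2).trans (MeasurableEquiv.sumCompl hF)), ?_⟩
  filter_upwards [hEae] with x hx
  have : (MeasurableEquiv.sumCompl hE).symm x = Sum.inl ⟨x, hx⟩ :=
    Equiv.sumCompl_symm_apply_of_pos hx
  rw [MeasurableEquiv.trans_apply, MeasurableEquiv.trans_apply, this]
  rfl

/-- Lusin–Souslin: an injective Borel map between standard Borel spaces is a measurable embedding.
-/
theorem exists_measurable_leftInverse_on [StandardBorelSpace X] [StandardBorelSpace Z] [Nonempty X]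
    {f : X → Z} (hf : Measurable f) {E : Set X} (hE : MeasurableSet E) (hinj : InjOn f E) :
    ∃ g : Z → X, Measurable g ∧ ∀ x ∈ E, g (f x) = x := by
  have := hE.standardBorel
  have hemb : MeasurableEmbedding (fun x : E => f x) :=
    (hf.comp measurable_subtype_coe).measurableEmbedding fun x y h =>
      Subtype.ext (hinj x.2 y.2 h)
  obtain ⟨g, hg, hgf⟩ := hemb.exists_measurable_extend (g := fun x : E => (x : X))
    measurable_subtype_coe fun _ => inferInstance
  exact ⟨g, hg, fun x hx => congrFun hgf ⟨x, hx⟩⟩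

theorem continuous_cdf (P : Measure ℝ) [IsProbabilityMeasure P] [NullSingletonClass P] :
    Continuous (ProbabilityTheory.cdf P) := by
  refine continuous_iff_continuousAt.2 fun a => ?_
  have hmono := (ProbabilityTheory.cdf P).mono
  have h := (ProbabilityTheory.cdf P).measure_singleton a
  rw [ProbabilityTheory.measure_cdf, measure_singleton, eq_comm, ENNReal.ofReal_eq_zero] at h
  rw [hmono.continuousAt_iff_leftLim_eq_rightLim, (ProbabilityTheory.cdf P).rightLim_eq]
  exact le_antisymm (hmono.leftLim_le le_rfl) (by linarith)

theorem map_cdf (P : Measure ℝ) [IsProbabilityMeasure P] [NullSingletonClass P] :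
    P.map (ProbabilityTheory.cdf P) = volume.restrict (Icc 0 1) := by
  have hcont := continuous_cdf P
  set F := ProbabilityTheory.cdf P with hF
  have hivt : ∀ t ∈ Ioo (0 : ℝ) 1, ∃ x, F x = t := fun t ht => by
    have := mem_range_of_exists_le_of_exists_ge hcont
      ((ProbabilityTheory.tendsto_cdf_atBot P).eventually_le_const ht.1).exists
      ((ProbabilityTheory.tendsto_cdf_atTop P).eventually_const_le ht.2).exists
    exact this
  have : IsProbabilityMeasure (P.map F) :=
    Measure.isProbabilityMeasure_map hcont.measurable.aemeasurable
  refine Measure.ext_of_Iic _ _ fun t => ?_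
  rw [Measure.map_apply hcont.measurable measurableSet_Iic,
    Measure.restrict_apply measurableSet_Iic]
  rcases lt_or_ge t 0 with ht | ht
  · have h1 : F ⁻¹' Iic t = ∅ := by
      ext x
      simpa using ht.trans_le (ProbabilityTheory.cdf_nonneg P x)
    have h2 : Iic t ∩ Icc 0 1 = ∅ := by
      ext x
      simp only [mem_inter_iff, mem_Iic, mem_Icc, mem_empty_iff_false, iff_false]
      intro h
      linarith [h.2.1]
    simp [h1, h2]
  rcases le_or_gt 1 t with ht1 | ht1
  · have h1 : F ⁻¹' Iic t = univ := by
      ext x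
      simpa using (ProbabilityTheory.cdf_le_one P x).trans ht1
    have h2 : Iic t ∩ Icc 0 1 = Icc (0 : ℝ) 1 :=
      inter_eq_right.2 fun x hx => hx.2.trans ht1
    simp [h1, h2]
  have h2 : Iic t ∩ Icc 0 1 = Icc 0 t := by
    ext x
    simp only [mem_inter_iff, mem_Iic, mem_Icc]
    constructor
    · rintro ⟨h, h', _⟩
      exact ⟨h', h⟩
    · rintro ⟨h, h'⟩
      exact ⟨h', h, h'.trans ht1.le⟩
  rw [h2, Real.volume_Icc, sub_zero]
  refine le_antisymm ?_ ?_
  -- `F` may have flat pieces, so `F ⁻¹' Iic t` is bounded from outside: it lies in `Iic x` whenever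
  -- `F x = s > t`, and then `s` decreases to `t`.
  · have hle : P.real (F ⁻¹' Iic t) ≤ t := by
      refine le_of_forall_gt_imp_ge_of_dense fun s hs => ?_
      rcases lt_or_ge s 1 with hs1 | hs1
      · obtain ⟨x, hx⟩ := hivt s ⟨ht.trans_lt hs, hs1⟩
        rw [← hx, hF, ProbabilityTheory.cdf_eq_real]
        refine measureReal_mono fun y hy => ?_
        by_contra hxy
        have h3 : F x ≤ F y := F.mono (not_le.1 hxy).le
        have h4 : F y ≤ t := hy
        linarith
      · exact measureReal_le_one.trans hs1
    rw [← ofReal_measureReal]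
    exact ENNReal.ofReal_le_ofReal hle
  · rcases ht.eq_or_lt with rfl | ht0
    · simp
    obtain ⟨x, hx⟩ := hivt t ⟨ht0, ht1⟩
    rw [← hx, hF, ProbabilityTheory.ofReal_cdf]
    exact measure_mono fun y hy => F.mono hy

theorem exists_map_eq_unitInterval [StandardBorelSpace X] [Nonempty X] (μ : Measure X)
    [IsProbabilityMeasure μ] [NullSingletonClass μ] :
    ∃ f : X → ℝ, ∃ g : ℝ → X, MeasurePreserving f μ (volume.restrict (Icc 0 1)) ∧
      Measurable g ∧ ∀ᵐ x ∂μ, g (f x) = x := by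
  obtain ⟨φ, hφ⟩ := exists_measurableEmbedding_real X
  let P := μ.map φ
  have : IsProbabilityMeasure P :=
    Measure.isProbabilityMeasure_map hφ.measurable.aemeasurable
  have : NullSingletonClass P := ⟨fun t => by
    rw [Measure.map_apply hφ.measurable (measurableSet_singleton t)]
    exact (subsingleton_singleton.preimage hφ.injective).measure_zero μ⟩
  let F := ProbabilityTheory.cdf P
  have hF : Measurable F := (continuous_cdf P).measurable
  have hmp : MeasurePreserving (F ∘ φ) μ (volume.restrict (Icc 0 1)) := by
    refine ⟨hF.comp hφ.measurable, ?_⟩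
    rw [← Measure.map_map hF hφ.measurable]
    exact map_cdf P
  -- Two points with the same value of `F` bound a flat piece of `F`, which contains a rational.
  -- Removing the countably many values `F q`, each of null preimage, leaves a set on which `F ∘ φ`
  -- is injective.
  let E : Set X := {x | ∀ q : ℚ, F (φ x) ≠ F q}
  have hE : MeasurableSet E := by
    have : E = ⋂ q : ℚ, {x | F (φ x) = F q}ᶜ := by ext; simp [E]
    rw [this]
    exact MeasurableSet.iInter fun q =>
      (hmp.measurable (measurableSet_singleton (F q))).compl
  have hEae : ∀ᵐ x ∂μ, x ∈ E := by
    refine ae_all_iff.2 fun q => ?_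
    refine hmp.quasiMeasurePreserving.ae (p := fun t => t ≠ F q) ?_
    exact measure_eq_zero_iff_ae_notMem.1 (measure_singleton (F q))
  have hlt : ∀ x ∈ E, ∀ y, φ x < φ y → F (φ x) < F (φ y) := by
    intro x hx y hxy
    obtain ⟨q, hq, hq'⟩ := exists_rat_btwn hxy
    exact ((F.mono hq.le).lt_of_ne (hx q)).trans_le (F.mono hq'.le)
  have hinj : InjOn (F ∘ φ) E := by
    intro x hx y hy h
    rcases lt_trichotomy (φ x) (φ y) with hxy | hxy | hxy
    · exact absurd h (hlt x hx y hxy).ne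
    · exact hφ.injective hxy
    · exact absurd h (hlt y hy x hxy).ne'
  obtain ⟨g, hg, hgE⟩ := exists_measurable_leftInverse_on hmp.measurable hE hinj
  exact ⟨F ∘ φ, g, hmp, hg, hEae.mono hgE⟩

/-- Non-atomic finite measures of the same mass on standard Borel spaces are isomorphic. -/
theorem exists_measurePreserving_of_measure_univ_eq [StandardBorelSpace X] [StandardBorelSpace Z]
    [Nonempty X] [Nonempty Z] (μ : Measure X) (ν : Measure Z) [IsFiniteMeasure μ]
    [IsFiniteMeasure ν] [NullSingletonClass μ] [NullSingletonClass ν] (h : μ univ = ν univ) :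
    ∃ f : X → Z, ∃ g : Z → X, MeasurePreserving f μ ν ∧ Measurable g ∧
      ∀ᵐ x ∂μ, g (f x) = x := by
  by_cases h0 : μ univ = 0
  · have hμ : μ = 0 := Measure.measure_univ_eq_zero.1 h0
    have hν : ν = 0 := Measure.measure_univ_eq_zero.1 (h ▸ h0)
    subst hμ hν
    exact ⟨fun _ => Classical.arbitrary Z, fun _ => Classical.arbitrary X,
      ⟨measurable_const, by simp⟩, measurable_const, by simp⟩
  have h0' : ν univ ≠ 0 := h ▸ h0
  have : NeZero μ := ⟨fun h => h0 (by simp [h])⟩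
  have : NeZero ν := ⟨fun h => h0' (by simp [h])⟩
  have : NullSingletonClass ((μ univ)⁻¹ • μ) := ⟨fun x => by simp⟩
  obtain ⟨f₁, g₁, hf₁, hg₁, hgf₁⟩ := exists_map_eq_unitInterval ((μ univ)⁻¹ • μ)
  have : NullSingletonClass ((ν univ)⁻¹ • ν) := ⟨fun x => by simp⟩
  obtain ⟨f₂, g₂, hf₂, hg₂, hgf₂⟩ := exists_map_eq_unitInterval ((ν univ)⁻¹ • ν)
  have hc : (μ univ)⁻¹ ≠ 0 := ENNReal.inv_ne_zero.2 (measure_ne_top μ _)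
  -- The isomorphism passes through the unit interval, so the second map has to be inverted.
  have hg₂mp : MeasurePreserving g₂ (volume.restrict (Icc 0 1)) ((ν univ)⁻¹ • ν) := by
    refine ⟨hg₂, ?_⟩
    rw [← hf₂.map_eq, Measure.map_map hg₂ hf₂.measurable]
    refine (Measure.map_congr (g := id) ?_).trans Measure.map_id
    exact hgf₂
  have hfg₂ : ∀ᵐ t ∂volume.restrict (Icc (0 : ℝ) 1), f₂ (g₂ t) = t := by
    rw [← hf₂.map_eq]
    refine (ae_map_iff hf₂.measurable.aemeasurable
      (measurableSet_eq_fun (hf₂.measurable.comp hg₂) measurable_id)).2 ?_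
    filter_upwards [hgf₂] with x hx
    exact congrArg f₂ hx
  have hcomp := hg₂mp.comp hf₁
  refine ⟨g₂ ∘ f₁, g₁ ∘ f₂, ⟨hcomp.measurable, ?_⟩, hg₁.comp hf₂.measurable, ?_⟩
  · have := hcomp.map_eq
    rw [Measure.map_smul, h] at this
    ext s hs
    have hs' := congrArg (fun κ : Measure Z => κ s) this
    change (ν univ)⁻¹ * _ = (ν univ)⁻¹ * _ at hs'
    exact (ENNReal.mul_right_inj (ENNReal.inv_ne_zero.2 (measure_ne_top ν _))
      (ENNReal.inv_ne_top.2 h0')).1 hs'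
  · have h3 := hf₁.quasiMeasurePreserving.ae hfg₂
    have h4 : ∀ᵐ x ∂((μ univ)⁻¹ • μ), (g₁ ∘ f₂) ((g₂ ∘ f₁) x) = x := by
      filter_upwards [hgf₁, h3] with x hx hx'
      rw [Function.comp_apply, Function.comp_apply, hx', hx]
    exact (Measure.ae_ennreal_smul_measure_iff hc).1 h4

end Isomorphism

/-! ### Coding points by a sequence of sets. -/

section Code

variable {X : Type*}

/-- The map that records which sets of a sequence contain a given point. -/
def code (A : ℕ → Set X) (x : X) (n : ℕ) : Bool :=
  open Classical in decide (x ∈ A n)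

theorem code_eq_true {A : ℕ → Set X} {x : X} {n : ℕ} : code A x n = true ↔ x ∈ A n := by
  simp [code]

/-- The cylinders in the Cantor space that prescribe finitely many coordinates to be `true`. -/
def trueCylinder (s : Finset ℕ) : Set (ℕ → Bool) := {c | ∀ n ∈ s, c n = true}

theorem code_preimage_trueCylinder (A : ℕ → Set X) (s : Finset ℕ) :
    code A ⁻¹' trueCylinder s = ⋂ n ∈ s, A n := by
  ext x
  simp [trueCylinder, code_eq_true]

end Code

/-! ### Limits of transformations, and Polishness. -/

section Limits

variable {X : Type*} [MeasurableSpace X] {μ : Measure X}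

theorem measure_le_add_symmDiff (s t : Set X) : μ s ≤ μ t + μ (symmDiff s t) := by
  refine (measure_mono fun x hx => ?_).trans (measure_union_le t (symmDiff s t))
  by_cases hxt : x ∈ t
  · exact Or.inl hxt
  · exact Or.inr (Or.inl ⟨hx, hxt⟩)

theorem measure_eq_of_tendsto_symmDiff {ι : Type*} {l : Filter ι} [l.NeBot] {B : ι → Set X}
    {F : Set X} {c : ℝ≥0∞} (hB : ∀ i, μ (B i) = c)
    (h : Tendsto (fun i => μ (symmDiff (B i) F)) l (𝓝 0)) : μ F = c := by
  refine le_antisymm ?_ ?_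
  · refine ge_of_tendsto' (by simpa using tendsto_const_nhds.add h) fun i => ?_
    rw [← hB i, symmDiff_comm]
    exact measure_le_add_symmDiff F (B i)
  · refine ge_of_tendsto' (by simpa using (tendsto_const_nhds (x := μ F)).add h) fun i => ?_
    rw [← hB i]
    exact measure_le_add_symmDiff (B i) F

theorem tendsto_symmDiff_inter {ι : Type*} {l : Filter ι} {B C : ι → Set X} {F G : Set X}
    (hB : Tendsto (fun i => μ (symmDiff (B i) F)) l (𝓝 0))
    (hC : Tendsto (fun i => μ (symmDiff (C i) G)) l (𝓝 0)) :
    Tendsto (fun i => μ (symmDiff (B i ∩ C i) (F ∩ G))) l (𝓝 0) := by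
  refine tendsto_of_tendsto_of_tendsto_of_le_of_le tendsto_const_nhds
    (by simpa using hB.add hC) (fun _ => zero_le) fun i => ?_
  refine (measure_mono fun x hx => ?_).trans (measure_union_le _ _)
  simp only [mem_union, mem_symmDiff, mem_inter_iff] at hx ⊢
  tauto

theorem measurable_code {A : ℕ → Set X} (hA : ∀ n, MeasurableSet (A n)) :
    Measurable (code A) := by
  refine measurable_pi_iff.2 fun n => measurable_to_bool ?_
  convert hA n
  ext x
  simp [code]

theorem generateFrom_trueCylinder :
    (MeasurableSpace.pi : MeasurableSpace (ℕ → Bool)) =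
      MeasurableSpace.generateFrom (range trueCylinder) := by
  refine le_antisymm ?_ (MeasurableSpace.generateFrom_le ?_)
  · refine iSup_le fun n => measurable_iff_comap_le.1 ?_
    refine @measurable_to_bool _ (_) _ ?_
    refine MeasurableSpace.measurableSet_generateFrom ⟨{n}, ?_⟩
    ext c
    simp [trueCylinder]
  · rintro _ ⟨s, rfl⟩
    have : trueCylinder s = ⋂ n ∈ s, (fun c : ℕ → Bool => c n) ⁻¹' {true} := by
      ext c
      simp [trueCylinder]
    rw [this]
    exact Finset.measurableSet_biInter _ fun n _ =>
      measurable_pi_apply n (measurableSet_singleton _)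

theorem isPiSystem_trueCylinder : IsPiSystem (range trueCylinder) := by
  classical
  rintro _ ⟨s, rfl⟩ _ ⟨t, rfl⟩ _
  refine ⟨s ∪ t, ?_⟩
  ext c
  simp [trueCylinder, or_imp, forall_and]

/-- If the images of the sets of a dense family converge, together with the inverse images, then
the inverse transformations have a limit, as a measure preserving map. -/
theorem DenseSeparating.exists_limit_map [StandardBorelSpace X] [Nonempty X] {A : ℕ → Set X}
    (hA : DenseSeparating μ A) {ι : Type*} {l : Filter ι} [l.NeBot] {u : ι → Aut μ}
    {F G : ℕ → Set X} (hF : ∀ n, MeasurableSet (F n)) (hG : ∀ n, MeasurableSet (G n))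
    (huF : ∀ n, Tendsto (fun i => μ (symmDiff ((u i).img (A n)) (F n))) l (𝓝 0))
    (huG : ∀ n, Tendsto (fun i => μ (symmDiff ((u i)⁻¹.img (A n)) (G n))) l (𝓝 0)) :
    ∃ S : X → X, MeasurePreserving S μ μ ∧ ∀ n, S ⁻¹' A n =ᵐ[μ] F n := by
  have hAm := measurable_code hA.meas
  have hFm := measurable_code hF
  have hGμ : ∀ n, μ (G n) = μ (A n) := fun n =>
    measure_eq_of_tendsto_symmDiff (fun i => (u i)⁻¹.measure_img (hA.meas n)) (huG n)
  have hD : ∀ s : Finset ℕ, Tendsto (fun i => μ (symmDiff ((u i).img (⋂ n ∈ s, A n))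
      (⋂ n ∈ s, F n))) l (𝓝 0) := by
    intro s
    induction s using Finset.induction with
    | empty =>
      have h0 : ∀ i, μ (symmDiff ((u i).img univ) (univ : Set X)) = 0 := fun i =>
        (congrArg μ (symmDiff_self (univ : Set X))).trans measure_empty
      simp only [Finset.notMem_empty, iInter_of_empty, iInter_univ, h0]
      exact tendsto_const_nhds
    | insert a s _ ih =>
      simp only [Finset.set_biInter_insert]
      exact tendsto_symmDiff_inter (huF a) ih
  have hinter : ∀ m (s : Finset ℕ), μ (F m ∩ ⋂ n ∈ s, F n) = μ (A m ∩ ⋂ n ∈ s, A n) := by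
    intro m s
    have hs : MeasurableSet (A m ∩ ⋂ n ∈ s, A n) :=
      (hA.meas m).inter (Finset.measurableSet_biInter _ fun n _ => hA.meas n)
    exact measure_eq_of_tendsto_symmDiff (l := l) (fun i => (u i).measure_img hs)
      (tendsto_symmDiff_inter (huF m) (hD s))
  -- The limit map will be `code F` followed by a left inverse of `code A`, so the two codes must
  -- have the same distribution. As `μ` may be infinite, this is checked on each `F m` and `A m`,
  -- where a π-system suffices.
  have hmap : ∀ m, (μ.restrict (F m)).map (code F) = (μ.restrict (A m)).map (code A) := by
    intro m
    have hF' : μ (F m) = μ (A m) := by simpa using hinter m ∅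
    have : IsFiniteMeasure (μ.restrict (F m)) :=
      ⟨by rw [Measure.restrict_apply_univ, hF']; exact (hA.fin m).lt_top⟩
    refine ext_of_generate_finite _ generateFrom_trueCylinder isPiSystem_trueCylinder ?_ ?_
    · rintro _ ⟨s, rfl⟩
      have hcyl : MeasurableSet (trueCylinder s) := by
        rw [generateFrom_trueCylinder]
        exact MeasurableSpace.measurableSet_generateFrom ⟨s, rfl⟩
      rw [Measure.map_apply hFm hcyl, Measure.map_apply hAm hcyl,
        Measure.restrict_apply (hFm hcyl), Measure.restrict_apply (hAm hcyl),
        code_preimage_trueCylinder, code_preimage_trueCylinder, inter_comm, hinter, inter_comm]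
    · rw [Measure.map_apply hFm MeasurableSet.univ, Measure.map_apply hAm MeasurableSet.univ]
      simpa using hF'
  -- Here the convergence of the inverse images enters: `A j \ uᵢ (A m)` has the measure of `uᵢ⁻¹ (A
  -- j) \ A m`, which is small in the limit when `A m` is close to `G j`.
  have hcover : ∀ᵐ x ∂μ, x ∈ ⋃ m, F m := by
    have h0 : ∀ j, μ (A j \ ⋃ m, F m) = 0 := by
      intro j
      refine nonpos_iff_eq_zero.1 (le_of_forall_pos_le_add fun ε hε => ?_)
      rw [zero_add]
      obtain ⟨m, hm⟩ := hA.dense (G j) (hG j) (by rw [hGμ]; exact hA.fin j) ε hε.ne'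
      have hlim : Tendsto (fun i => μ (symmDiff ((u i)⁻¹.img (A j)) (G j)) +
          μ (symmDiff (G j) (A m)) + μ (symmDiff ((u i).img (A m)) (F m))) l
          (𝓝 (μ (symmDiff (G j) (A m)))) := by
        simpa using ((huG j).add tendsto_const_nhds).add (huF m)
      refine (ge_of_tendsto' hlim fun i => ?_).trans hm.le
      calc μ (A j \ ⋃ m, F m) ≤ μ ((A j \ (u i).img (A m)) ∪ symmDiff ((u i).img (A m)) (F m)) := by
            refine measure_mono fun x hx => ?_
            by_cases hxm : x ∈ (u i).img (A m)
            · exact Or.inr (Or.inl ⟨hxm, fun h => hx.2 (mem_iUnion.2 ⟨m, h⟩)⟩)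
            · exact Or.inl ⟨hx.1, hxm⟩
        _ ≤ μ (A j \ (u i).img (A m)) + μ (symmDiff ((u i).img (A m)) (F m)) :=
            measure_union_le _ _
        _ ≤ _ := by
            gcongr
            rw [← (u i).measure_diff_img_inv (hA.meas j) (hA.meas m)]
            refine (measure_mono ?_).trans (measure_symmDiff_triangle _ (G j) _)
            exact fun x hx => Or.inl hx
    have h1 : ∀ j, ∀ᵐ x ∂μ, x ∈ A j → x ∈ ⋃ m, F m := fun j => by
      refine (measure_eq_zero_iff_ae_notMem.1 (h0 j)).mono fun x hx hxA => ?_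
      by_contra hxF
      exact hx ⟨hxA, hxF⟩
    filter_upwards [ae_all_iff.2 h1] with x hx
    obtain ⟨j, hj⟩ := mem_iUnion.1 (hA.cover ▸ mem_univ x : x ∈ ⋃ n, A n)
    exact hx j hj
  have hinj : Function.Injective (code A) := fun x y h =>
    hA.sep x y fun n => by rw [← code_eq_true, ← code_eq_true, h]
  have hemb : MeasurableEmbedding (code A) := hAm.measurableEmbedding hinj
  obtain ⟨g, hg, hgA⟩ := exists_measurable_leftInverse_on hAm MeasurableSet.univ hinj.injOn
  have hrange : ∀ᵐ x ∂μ, code F x ∈ range (code A) := by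
    have h1 : ∀ m, ∀ᵐ x ∂μ, x ∈ F m → code F x ∈ range (code A) := fun m => by
      rw [← ae_restrict_iff' (hF m)]
      refine (ae_map_iff (p := fun c => c ∈ range (code A)) hFm.aemeasurable
        hemb.measurableSet_range).1 ?_
      rw [hmap m]
      exact (ae_map_iff (p := fun c => c ∈ range (code A)) hAm.aemeasurable
        hemb.measurableSet_range).2 (Eventually.of_forall fun x => mem_range_self x)
    filter_upwards [hcover, ae_all_iff.2 h1] with x hx hx1
    obtain ⟨m, hm⟩ := mem_iUnion.1 hx
    exact hx1 m hm
  have hSA : ∀ n, (g ∘ code F) ⁻¹' A n =ᵐ[μ] F n := by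
    intro n
    filter_upwards [hrange] with x hx
    obtain ⟨y, hy⟩ := hx
    refine propext ?_
    change g (code F x) ∈ A n ↔ x ∈ F n
    rw [← hy, hgA y (mem_univ y), ← code_eq_true, hy, code_eq_true]
  have hS : Measurable (g ∘ code F) := hg.comp hFm
  refine ⟨g ∘ code F, ⟨hS, ?_⟩, hSA⟩
  refine Measure.ext_of_iUnion_eq_univ hA.cover fun m => ?_
  rw [Measure.restrict_map hS (hA.meas m), Measure.restrict_congr_set (hSA m),
    ← Measure.map_map hg hFm, hmap m, Measure.map_map hg hAm]
  have : g ∘ code A = id := funext fun x => hgA x (mem_univ x)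
  rw [this, Measure.map_id]

/-- The element of `Aut(X, μ)` given by a measure preserving measurable equivalence. -/
def Aut.ofMeasurableEquiv (e : X ≃ᵐ X) (he : MeasurePreserving e μ μ) : Aut μ :=
  Aut.mk ⟨e.toEquiv, he, he.symm e⟩

theorem Aut.rep_ofMeasurableEquiv (e : X ≃ᵐ X) (he : MeasurePreserving e μ μ) :
    ((Aut.ofMeasurableEquiv e he).rep : X → X) =ᵐ[μ] e :=
  Aut.rep_mk _

/-- Let `S` and `R` be the limit maps with `S ⁻¹' A n = F n` and `R ⁻¹' A n = G n`. Then `S ∘ R =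
id` almost everywhere, because `R ⁻¹' F n = A n`: if `A m` is close to `F n`, then `R ⁻¹' F n` is
close to `G m`, the limit of `uᵢ⁻¹ (A m)`, which is close to `uᵢ⁻¹ (F n)` and so to `A n`. Hence `R`
is an isomorphism up to a null set, with inverse `S`. -/
theorem DenseSeparating.exists_limit [StandardBorelSpace X] [SigmaFinite μ] [NullSingletonClass μ]
    (hμ : μ ≠ 0) {A : ℕ → Set X} (hA : DenseSeparating μ A) {ι : Type*} {l : Filter ι} [l.NeBot]
    {u : ι → Aut μ} {F G : ℕ → Set X} (hF : ∀ n, MeasurableSet (F n))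
    (hG : ∀ n, MeasurableSet (G n))
    (huF : ∀ n, Tendsto (fun i => μ (symmDiff ((u i).img (A n)) (F n))) l (𝓝 0))
    (huG : ∀ n, Tendsto (fun i => μ (symmDiff ((u i)⁻¹.img (A n)) (G n))) l (𝓝 0)) :
    ∃ T : Aut μ, ∀ n, T.img (A n) =ᵐ[μ] F n := by
  have : Nonempty X := by
    by_contra h
    rw [not_nonempty_iff] at h
    exact hμ (Measure.eq_zero_of_isEmpty μ)
  obtain ⟨S, hS, hSA⟩ := hA.exists_limit_map hF hG huF huG
  obtain ⟨R, hR, hRA⟩ := hA.exists_limit_map (u := fun i => (u i)⁻¹) hG hF huG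
    (by simpa only [inv_inv] using huF)
  have hFμ : ∀ n, μ (F n) = μ (A n) := fun n =>
    measure_eq_of_tendsto_symmDiff (fun i => (u i).measure_img (hA.meas n)) (huF n)
  have hRF : ∀ n, R ⁻¹' F n =ᵐ[μ] A n := by
    intro n
    refine measure_symmDiff_eq_zero_iff.1
      (nonpos_iff_eq_zero.1 (le_of_forall_pos_le_add fun ε hε => ?_))
    rw [zero_add]
    have hε2 : ε / 2 ≠ 0 := (ENNReal.half_pos hε.ne').ne'
    obtain ⟨m, hm⟩ := hA.dense (F n) (hF n) (by rw [hFμ]; exact hA.fin n) _ hε2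
    have h1 : μ (symmDiff (R ⁻¹' F n) (G m)) ≤ ε / 2 := by
      have h0 : μ (symmDiff (R ⁻¹' F n) (G m)) = μ (R ⁻¹' symmDiff (F n) (A m)) :=
        (measure_symmDiff_congr (ae_eq_refl _) (hRA m)).symm
      rw [h0, hR.measure_preimage ((hF n).symmDiff (hA.meas m)).nullMeasurableSet]
      exact hm.le
    have h2 : μ (symmDiff (G m) (A n)) ≤ ε / 2 := by
      have hlim : Tendsto (fun i => μ (symmDiff ((u i)⁻¹.img (A m)) (G m)) +
          (μ (symmDiff (F n) (A m)) + μ (symmDiff ((u i).img (A n)) (F n)))) l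
          (𝓝 (μ (symmDiff (F n) (A m)))) := by
        simpa using (huG m).add (tendsto_const_nhds.add (huF n))
      refine (ge_of_tendsto' hlim fun i => ?_).trans hm.le
      refine (measure_symmDiff_triangle _ ((u i)⁻¹.img (A m)) _).trans ?_
      rw [symmDiff_comm (G m), symmDiff_comm ((u i)⁻¹.img (A m)) (A n),
        (u i).measure_symmDiff_img_inv (hA.meas n) (hA.meas m)]
      gcongr
      rw [add_comm]
      exact measure_symmDiff_triangle _ _ _
    calc _ ≤ μ (symmDiff (R ⁻¹' F n) (G m)) + μ (symmDiff (G m) (A n)) :=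
          measure_symmDiff_triangle _ _ _
      _ ≤ ε / 2 + ε / 2 := add_le_add h1 h2
      _ = ε := ENNReal.add_halves ε
  have hSR : ∀ᵐ x ∂μ, S (R x) = x := by
    refine hA.ae_eq (f := S ∘ R) (g := id) fun n => ?_
    exact (hR.quasiMeasurePreserving.preimage_ae_eq (hSA n)).trans (hRF n)
  obtain ⟨e, he⟩ := exists_measurableEquiv_ae_eq hμ hR hS.measurable hSR
  have hemp : MeasurePreserving e μ μ :=
    ⟨e.measurable, by rw [Measure.map_congr he, hR.map_eq]⟩
  refine ⟨Aut.ofMeasurableEquiv e hemp, fun n => ?_⟩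
  have hsymm : ∀ᵐ y ∂μ, S y = e.symm y := by
    have h : ∀ᵐ x ∂μ, S (e x) = x := by
      filter_upwards [he, hSR] with x hx hx'
      rw [hx, hx']
    filter_upwards [(hemp.symm e).quasiMeasurePreserving.ae h] with y hy
    rwa [MeasurableEquiv.apply_symm_apply] at hy
  have h1 := ae_eq_symm_of_ae_eq (f := e.toEquiv) (hemp.symm e) (Aut.rep_ofMeasurableEquiv e hemp)
  filter_upwards [hsymm, h1, hSA n] with y hy hy1 hy2
  rw [← hy2]
  change ((Aut.ofMeasurableEquiv e hemp).rep.symm y ∈ A n) = (S y ∈ A n)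
  rw [hy1, hy]
  rfl

/-- On `B i ∆ F` the indicator of `B i` and `f` differ by at least `1/2`, and `L¹` convergence
implies convergence in measure. -/
theorem tendsto_measure_symmDiff_of_tendsto_indicatorConstLp {ι : Type*} {l : Filter ι}
    {B : ι → Set X} {hB : ∀ i, MeasurableSet (B i)} {hBf : ∀ i, μ (B i) ≠ ∞} {f : Lp ℝ 1 μ}
    (h : Tendsto (fun i => indicatorConstLp 1 (hB i) (hBf i) (1 : ℝ)) l (𝓝 f)) {F : Set X}
    (hF : ∀ᵐ x ∂μ, x ∈ F ↔ 1 / 2 < f x) :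
    Tendsto (fun i => μ (symmDiff (B i) F)) l (𝓝 0) := by
  have h1 := tendstoInMeasure_of_tendsto_Lp h (ENNReal.ofReal (1 / 2)) (by simp)
  refine tendsto_of_tendsto_of_tendsto_of_le_of_le tendsto_const_nhds h1 (fun _ => zero_le)
    fun i => ?_
  refine measure_mono_ae ?_
  filter_upwards [hF, indicatorConstLp_coeFn (p := 1) (hs := hB i) (hμs := hBf i) (c := (1 : ℝ))]
    with x hx hx1 hxs
  change ENNReal.ofReal (1 / 2) ≤ edist _ _
  rw [hx1, edist_dist, Real.dist_eq]
  refine ENNReal.ofReal_le_ofReal ?_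
  rcases hxs with ⟨hxB, hxF⟩ | ⟨hxF, hxB⟩
  · rw [indicator_of_mem hxB]
    have := not_lt.1 (fun h => hxF (hx.2 h))
    exact le_trans (by linarith) (le_abs_self _)
  · rw [indicator_of_notMem hxB]
    have := hx.1 hxF
    exact le_trans (by linarith) (neg_le_abs _)

/-- The indicators of the images of a sequence of sets, as elements of `L¹`. -/
def Aut.indicators {A : ℕ → Set X} (hA : DenseSeparating μ A) (T : Aut μ) (n : ℕ) : Lp ℝ 1 μ :=
  indicatorConstLp 1 (T.measurableSet_img (hA.meas n))
    (by rw [T.measure_img (hA.meas n)]; exact hA.fin n) (1 : ℝ)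

theorem Aut.continuous_indicators {A : ℕ → Set X} (hA : DenseSeparating μ A) :
    Continuous (Aut.indicators hA) := by
  refine continuous_pi fun n => continuous_indicatorConstLp_set ENNReal.one_ne_top fun T => ?_
  simp_rw [symmDiff_comm _ (T.img (A n))]
  exact Aut.tendsto_iff.1 tendsto_id (A n) (hA.meas n) (hA.fin n)

theorem Aut.isInducing_indicators {A : ℕ → Set X} (hA : DenseSeparating μ A) :
    IsInducing (Aut.indicators hA) := by
  refine isInducing_iff_nhds.2 fun T => le_antisymm
    (map_le_iff_le_comap.1 (Aut.continuous_indicators hA).continuousAt) ?_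
  have h : Tendsto (Aut.indicators hA) (comap (Aut.indicators hA) (𝓝 (Aut.indicators hA T)))
      (𝓝 (Aut.indicators hA T)) := tendsto_comap
  refine tendsto_id'.1 (hA.tendsto fun n => ?_)
  simp_rw [symmDiff_comm (T.img (A n))]
  refine tendsto_measure_symmDiff_of_tendsto_indicatorConstLp (tendsto_pi_nhds.1 h n) ?_
  filter_upwards [indicatorConstLp_coeFn (p := 1) (hs := T.measurableSet_img (hA.meas n))
    (hμs := by rw [T.measure_img (hA.meas n)]; exact hA.fin n) (c := (1 : ℝ))] with x hx
  rw [Aut.indicators, hx]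
  by_cases hxA : x ∈ T.img (A n)
  · simp only [hxA, indicator_of_mem, true_iff]
    norm_num
  · simp only [hxA, not_false_eq_true, indicator_of_notMem, false_iff]
    norm_num

theorem Aut.continuous_inv : Continuous (fun T : Aut μ => T⁻¹) := by
  refine continuous_iff_continuousAt.2 fun T => Aut.tendsto_iff.2 fun B hB hBf => ?_
  have h := Aut.tendsto_iff.1 (tendsto_id (x := 𝓝 T)) (T⁻¹.img B) (T⁻¹.measurableSet_img hB)
    (by rwa [T⁻¹.measure_img hB])
  refine h.congr fun S => ?_
  have hTB : T.img (T⁻¹.img B) =ᵐ[μ] B := by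
    have h1 := Aut.img_mul T T⁻¹ B
    rw [mul_inv_cancel] at h1
    exact h1.symm.trans (Aut.img_one B)
  have h2 : μ (symmDiff (T.img (T⁻¹.img B)) (S.img (T⁻¹.img B))) =
      μ (symmDiff B (S.img (T⁻¹.img B))) := measure_symmDiff_congr hTB (ae_eq_refl _)
  change μ (symmDiff (T.img (T⁻¹.img B)) (S.img (T⁻¹.img B))) =
    μ (symmDiff (T⁻¹.img B) (S⁻¹.img B))
  rw [h2, S.measure_symmDiff_img_inv
    (T⁻¹.measurableSet_img hB) hB, symmDiff_comm]

theorem Aut.injective_indicators {A : ℕ → Set X} (hA : DenseSeparating μ A) :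
    Function.Injective (Aut.indicators hA) := by
  intro S T h
  have h1 : ∀ n, S.img (A n) =ᵐ[μ] T.img (A n) := fun n => by
    have h2 := congrFun h n
    have h3 := indicatorConstLp_coeFn (p := 1) (hs := S.measurableSet_img (hA.meas n))
      (hμs := by rw [S.measure_img (hA.meas n)]; exact hA.fin n) (c := (1 : ℝ))
    have h4 := indicatorConstLp_coeFn (p := 1) (hs := T.measurableSet_img (hA.meas n))
      (hμs := by rw [T.measure_img (hA.meas n)]; exact hA.fin n) (c := (1 : ℝ))
    rw [Aut.indicators, Aut.indicators] at h2
    rw [h2] at h3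
    filter_upwards [h3, h4] with x hx hx'
    refine propext ?_
    change x ∈ S.img (A n) ↔ x ∈ T.img (A n)
    rw [hx] at hx'
    by_cases hS : x ∈ S.img (A n) <;> by_cases hT : x ∈ T.img (A n) <;> simp_all
  have h5 : (S.rep.symm : X → X) =ᵐ[μ] T.rep.symm := hA.ae_eq h1
  exact Aut.eq_iff.2 (ae_eq_symm_of_ae_eq (e := S.rep.symm) (f := T.rep.symm) T.rep_mp h5)

/-- The inverse is recorded because convergence of the images under `T` alone would not guarantee an
invertible limit. -/
theorem Aut.isClosedEmbedding_indicators [StandardBorelSpace X] [SigmaFinite μ]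
    [NullSingletonClass μ] (hμ : μ ≠ 0) {A : ℕ → Set X} (hA : DenseSeparating μ A) :
    IsClosedEmbedding (fun T : Aut μ => (Aut.indicators hA T, Aut.indicators hA T⁻¹)) := by
  have hcont : Continuous (fun T : Aut μ => (Aut.indicators hA T, Aut.indicators hA T⁻¹)) :=
    (Aut.continuous_indicators hA).prodMk ((Aut.continuous_indicators hA).comp Aut.continuous_inv)
  have hind : IsInducing (fun T : Aut μ => (Aut.indicators hA T, Aut.indicators hA T⁻¹)) :=
    .of_comp hcont continuous_fst (Aut.isInducing_indicators hA)
  refine ⟨⟨hind, fun S T h => Aut.injective_indicators hA (Prod.ext_iff.1 h).1⟩, ?_⟩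
  refine IsSeqClosed.isClosed ?_
  rintro w ⟨f, g⟩ hw hlim
  choose u hu using hw
  obtain rfl : (fun i => (Aut.indicators hA (u i), Aut.indicators hA (u i)⁻¹)) = w := funext hu
  have hfin : ∀ (T : Aut μ) n, μ (T.img (A n)) ≠ ∞ := fun T n => by
    rw [T.measure_img (hA.meas n)]; exact hA.fin n
  have hf := tendsto_pi_nhds.1 ((continuous_fst.tendsto _).comp hlim)
  have hg := tendsto_pi_nhds.1 ((continuous_snd.tendsto _).comp hlim)
  have hset : ∀ φ : Lp ℝ 1 μ, MeasurableSet {x | 1 / 2 < φ x} := fun φ =>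
    measurableSet_lt measurable_const (Lp.stronglyMeasurable φ).measurable
  have huF : ∀ n, Tendsto (fun i => μ (symmDiff ((u i).img (A n)) {x | 1 / 2 < f n x})) atTop
      (𝓝 0) := fun n => tendsto_measure_symmDiff_of_tendsto_indicatorConstLp
        (hB := fun i => Aut.measurableSet_img _ (hA.meas n)) (hBf := fun i => hfin _ n) (hf n)
        (Eventually.of_forall fun x => Iff.rfl)
  have huG : ∀ n, Tendsto (fun i => μ (symmDiff ((u i)⁻¹.img (A n)) {x | 1 / 2 < g n x})) atTop
      (𝓝 0) := fun n => tendsto_measure_symmDiff_of_tendsto_indicatorConstLp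
        (hB := fun i => Aut.measurableSet_img _ (hA.meas n)) (hBf := fun i => hfin _ n) (hg n)
        (Eventually.of_forall fun x => Iff.rfl)
  obtain ⟨T, hT⟩ := hA.exists_limit hμ (fun n => hset (f n)) (fun n => hset (g n)) huF huG
  have huT : Tendsto u atTop (𝓝 T) := hA.tendsto fun n => by
    refine (huF n).congr fun i => ?_
    rw [symmDiff_comm]
    exact measure_symmDiff_congr (hT n).symm (ae_eq_refl _)
  exact ⟨T, tendsto_nhds_unique ((hcont.tendsto T).comp huT) hlim⟩

theorem Aut.polishSpace [StandardBorelSpace X] [SigmaFinite μ] [NullSingletonClass μ]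
    (hμ : μ ≠ 0) : PolishSpace (Aut μ) := by
  obtain ⟨A, hA⟩ := exists_denseSeparating μ
  have : Fact ((1 : ℝ≥0∞) ≠ ∞) := ⟨ENNReal.one_ne_top⟩
  exact (Aut.isClosedEmbedding_indicators hμ hA).polishSpace

theorem ZdAction.polishSpace (d : ℕ) [StandardBorelSpace X] [SigmaFinite μ]
    [NullSingletonClass μ] (hμ : μ ≠ 0) : PolishSpace (ZdAction d μ) := by
  have := Aut.polishSpace hμ
  have : Countable (Multiplicative (Fin d → ℤ)) := inferInstanceAs (Countable (Fin d → ℤ))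
  exact ContinuousMonoidHom.isClosedEmbedding_coe.polishSpace

end Limits

/-! ### Splitting off a probability factor while keeping given sets. -/

section Inflation

variable {X : Type*} [MeasurableSpace X] {μ : Measure X}

/-- A non-atomic space is isomorphic to its product with a probability space, by an isomorphism
that preserves the atoms of a given countable partition. -/
theorem exists_measurableEquiv_prod [StandardBorelSpace X] [SigmaFinite μ] [NullSingletonClass μ]
    (hμ : μ ≠ 0) {Y : Type*} [MeasurableSpace Y] [StandardBorelSpace Y] (ν : Measure Y)
    [IsProbabilityMeasure ν] {κ : Type*} [Countable κ] [MeasurableSpace κ]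
    [MeasurableSingletonClass κ] {p : X → κ} (hp : Measurable p) (hfin : ∀ i, μ (p ⁻¹' {i}) ≠ ∞) :
    ∃ e : X ≃ᵐ Y × X, MeasurePreserving e μ (ν.prod μ) ∧ ∀ᵐ x ∂μ, p (e x).2 = p x := by
  have hX : Nonempty X := by
    by_contra h
    rw [not_nonempty_iff] at h
    exact hμ (Measure.eq_zero_of_isEmpty μ)
  have hY : Nonempty Y := nonempty_of_isProbabilityMeasure ν
  have hpm : ∀ i, MeasurableSet (p ⁻¹' {i}) := fun i => hp (measurableSet_singleton i)
  -- Since `ν` has mass one, an atom and its product with `Y` have equal finite mass. The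
  -- isomorphisms of the separate atoms are then glued.
  have hiso : ∀ i, ∃ f : X → Y × X, ∃ g : Y × X → X,
      MeasurePreserving f (μ.restrict (p ⁻¹' {i})) (ν.prod (μ.restrict (p ⁻¹' {i}))) ∧
        Measurable g ∧ ∀ᵐ x ∂μ.restrict (p ⁻¹' {i}), g (f x) = x := by
    intro i
    have : IsFiniteMeasure (μ.restrict (p ⁻¹' {i})) :=
      ⟨by rw [Measure.restrict_apply_univ]; exact (hfin i).lt_top⟩
    refine exists_measurePreserving_of_measure_univ_eq _ _ ?_
    rw [← univ_prod_univ, Measure.prod_prod, measure_univ (μ := ν), one_mul]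
  choose f g hf hg hgf using hiso
  have hfm : Measurable fun x => f (p x) x :=
    (measurable_from_prod_countable_left (f := fun z : X × κ => f z.2 z.1)
      fun i => (hf i).measurable).comp (measurable_id.prodMk hp)
  have hgm : Measurable fun z : Y × X => g (p z.2) z :=
    (measurable_from_prod_countable_left (f := fun w : (Y × X) × κ => g w.2 w.1)
      fun i => hg i).comp (measurable_id.prodMk (hp.comp measurable_snd))
  have hpf' : ∀ i, ∀ᵐ x ∂μ.restrict (p ⁻¹' {i}), p (f i x).2 = i := fun i => by
    have h1 : ∀ᵐ x ∂μ.restrict (p ⁻¹' {i}), p x = i := ae_restrict_mem (hpm i)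
    exact (hf i).quasiMeasurePreserving.ae (Measure.quasiMeasurePreserving_snd.ae h1)
  have hpf : ∀ᵐ x ∂μ, p (f (p x) x).2 = p x := by
    have h1 : ∀ i, ∀ᵐ x ∂μ, x ∈ p ⁻¹' {i} → p (f i x).2 = i := fun i =>
      (ae_restrict_iff' (hpm i)).1 (hpf' i)
    filter_upwards [ae_all_iff.2 h1] with x hx using hx (p x) rfl
  have hgfx : ∀ᵐ x ∂μ, g (p (f (p x) x).2) (f (p x) x) = x := by
    have h1 : ∀ i, ∀ᵐ x ∂μ, x ∈ p ⁻¹' {i} → g i (f i x) = x := fun i =>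
      (ae_restrict_iff' (hpm i)).1 (hgf i)
    filter_upwards [ae_all_iff.2 h1, hpf] with x hx hx'
    rw [hx']
    exact hx (p x) rfl
  have hmp : MeasurePreserving (fun x => f (p x) x) μ (ν.prod μ) := by
    refine ⟨hfm, ?_⟩
    have hcov : ⋃ i, (univ ×ˢ (p ⁻¹' {i}) : Set (Y × X)) = univ :=
      eq_univ_of_forall fun z => mem_iUnion.2 ⟨p z.2, mem_univ _, rfl⟩
    refine Measure.ext_of_iUnion_eq_univ hcov fun i => ?_
    rw [Measure.restrict_map hfm (MeasurableSet.univ.prod (hpm i)), ← Measure.prod_restrict,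
      Measure.restrict_univ, ← (hf i).map_eq]
    have hset : (fun x => f (p x) x) ⁻¹' (univ ×ˢ (p ⁻¹' {i})) =ᵐ[μ] p ⁻¹' {i} := by
      filter_upwards [hpf] with x hx
      refine propext ?_
      change (f (p x) x ∈ (univ ×ˢ (p ⁻¹' {i}) : Set (Y × X))) ↔ p x = i
      simp [hx]
    rw [Measure.restrict_congr_set hset]
    refine Measure.map_congr ?_
    filter_upwards [ae_restrict_mem (hpm i)] with x hx
    rw [show p x = i from hx]
  obtain ⟨e, he⟩ := exists_measurableEquiv_ae_eq (ν := ν.prod μ) hμ hmp hgm hgfx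
  refine ⟨e, ⟨e.measurable, by rw [Measure.map_congr he, hmp.map_eq]⟩, ?_⟩
  filter_upwards [he, hpf] with x hx hx'
  rw [hx, hx']

/-- The atoms record membership in the first `k` sets, and also the index of a spanning set to make
their measure finite. -/
theorem exists_partition [SigmaFinite μ] {C : ℕ → Set X}
    (hC : ∀ n, MeasurableSet (C n)) (k : ℕ) :
    ∃ p : X → (Fin k → Bool) × ℕ, Measurable p ∧ (∀ i, μ (p ⁻¹' {i}) ≠ ∞) ∧
      ∀ m < k, ∃ J, C m = p ⁻¹' J := by
  refine ⟨fun x => (fun m => code C x m, spanningSetsIndex μ x), ?_, fun i => ?_, fun m hm => ?_⟩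
  · refine Measurable.prodMk (measurable_pi_iff.2 fun m => ?_) (measurableSet_spanningSetsIndex μ)
    exact measurable_pi_iff.1 (measurable_code hC) m
  · refine ne_top_of_le_ne_top (measure_spanningSets_lt_top μ i.2).ne (measure_mono ?_)
    refine (show _ ⊆ spanningSetsIndex μ ⁻¹' {i.2} from fun x hx => ?_).trans ?_
    · exact congrArg Prod.snd (show _ = i from hx)
    · rw [preimage_spanningSetsIndex_singleton]
      exact disjointed_subset _ _
  · refine ⟨{q | q.1 ⟨m, hm⟩ = true}, ?_⟩
    ext x
    exact code_eq_true.symm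

end Inflation

/-! ### The finite torus and its coboundary cocycle. -/

section Torus

/-- The uniform probability measure on `(ℤ/N)^d`. -/
def torusMeasure (d N : ℕ) [NeZero N] : Measure (Fin d → ZMod N) :=
  Measure.pi fun _ => (N : ℝ≥0∞)⁻¹ • Measure.count

variable {d N : ℕ}

/-- The image of `γ ∈ ℤ^d` in `(ℤ/N)^d`. -/
def torusProj (N : ℕ) (γ : Fin d → ℤ) (i : Fin d) : ZMod N := (γ i : ZMod N)

theorem torusProj_add (γ δ : Fin d → ℤ) :
    torusProj N (γ + δ) = torusProj N γ + torusProj N δ := by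
  ext i
  simp [torusProj]

/-- The representative in `[0, N)^d` of an element of `(ℤ/N)^d`. -/
def torusRep (y : Fin d → ZMod N) (i : Fin d) : ℤ := (y i).val

/-- The coboundary `[y + γ] - [y]`, a cocycle of `ℤ^d` over the translations of `(ℤ/N)^d`. -/
def torusCocycle (γ : Fin d → ℤ) (y : Fin d → ZMod N) : Fin d → ℤ :=
  torusRep (y + torusProj N γ) - torusRep y

theorem torusCocycle_add (γ δ : Fin d → ℤ) (y : Fin d → ZMod N) :
    torusCocycle (γ + δ) y = torusCocycle γ (y + torusProj N δ) + torusCocycle δ y := by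
  simp [torusCocycle, torusProj_add, add_assoc, add_comm (torusProj N δ)]

variable [NeZero N]

theorem zmod_isProbabilityMeasure :
    IsProbabilityMeasure ((N : ℝ≥0∞)⁻¹ • Measure.count : Measure (ZMod N)) := by
  refine ⟨?_⟩
  rw [Measure.smul_apply, Measure.count_univ, smul_eq_mul, ENat.card_eq_coe_fintype_card,
    ZMod.card]
  exact ENNReal.inv_mul_cancel (by simp [NeZero.ne N]) (by simp)

instance : IsProbabilityMeasure (torusMeasure d N) := by
  have := zmod_isProbabilityMeasure (N := N)
  exact Measure.pi.instIsProbabilityMeasure _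

instance : (torusMeasure d N).IsAddRightInvariant := by
  have := zmod_isProbabilityMeasure (N := N)
  exact Measure.pi.isAddRightInvariant _

theorem zmod_val_sub_intCast {z : ZMod N} {g : ℤ} (h0 : 0 ≤ (z.val : ℤ) - g)
    (h1 : (z.val : ℤ) - g < N) : ((z - (g : ZMod N)).val : ℤ) = z.val - g := by
  have h : z - (g : ZMod N) = (((z.val : ℤ) - g : ℤ) : ZMod N) := by simp
  rw [h, ZMod.val_intCast, Int.emod_eq_of_lt h0 h1]

theorem zmod_measure_le (g : ℤ) :
    ((N : ℝ≥0∞)⁻¹ • Measure.count : Measure (ZMod N))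
      {z | ¬(0 ≤ (z.val : ℤ) - g ∧ (z.val : ℤ) - g < N)} ≤ (N : ℝ≥0∞)⁻¹ * g.natAbs := by
  classical
  rw [Measure.smul_apply, smul_eq_mul]
  gcongr
  rw [Measure.count_apply_finite _ (Set.toFinite _)]
  norm_cast
  have hinj : Set.InjOn (ZMod.val : ZMod N → ℕ) Set.univ := (ZMod.val_injective N).injOn
  rcases le_total 0 g with hg | hg
  · refine (Finset.card_le_card_of_injOn ZMod.val (t := Finset.range g.natAbs) ?_
      (hinj.mono (subset_univ _))).trans (by simp)
    intro z hz
    simp only [Finite.coe_toFinset, mem_ofPred_eq] at hz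
    have := ZMod.val_lt z
    simp only [Finset.coe_range, mem_Iio]
    omega
  · refine (Finset.card_le_card_of_injOn ZMod.val (t := Finset.Ico (N - g.natAbs) N) ?_
      (hinj.mono (subset_univ _))).trans (by rw [Nat.card_Ico]; omega)
    intro z hz
    simp only [Finite.coe_toFinset, mem_ofPred_eq] at hz
    have := ZMod.val_lt z
    simp only [Finset.coe_Ico, mem_Ico]
    omega

/-- The cocycle can differ from `γ` only if some coordinate wraps around; coordinate `i` does so for
at most `|γ i|` of the `N` residues. The shift by `γ` parametrizes by the endpoint of the
translation, as images of sets require. -/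
theorem torusMeasure_cocycle_ne_le (γ : Fin d → ℤ) :
    torusMeasure d N {y | torusCocycle γ (y - torusProj N γ) ≠ γ} ≤
      (N : ℝ≥0∞)⁻¹ * ∑ i, ((γ i).natAbs : ℝ≥0∞) := by
  have := zmod_isProbabilityMeasure (N := N)
  have hsub : {y : Fin d → ZMod N | torusCocycle γ (y - torusProj N γ) ≠ γ} ⊆
      ⋃ i, (fun y : Fin d → ZMod N => y i) ⁻¹'
        {z | ¬(0 ≤ (z.val : ℤ) - γ i ∧ (z.val : ℤ) - γ i < N)} := by
    intro y hy
    by_contra hcon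
    refine hy (funext fun i => ?_)
    simp only [mem_iUnion, not_exists, mem_preimage, mem_ofPred_eq, not_not] at hcon
    have h := zmod_val_sub_intCast (hcon i).1 (hcon i).2
    simp only [torusCocycle, torusRep, torusProj, sub_add_cancel, Pi.sub_apply] at h ⊢
    rw [h]
    ring
  refine (measure_mono hsub).trans ((measure_iUnion_le _).trans ?_)
  rw [tsum_fintype, Finset.mul_sum]
  refine Finset.sum_le_sum fun i _ => ?_
  have h := (measurePreserving_eval
    (fun _ : Fin d => ((N : ℝ≥0∞)⁻¹ • Measure.count : Measure (ZMod N))) i).measure_preimage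
    (s := {z | ¬(0 ≤ (z.val : ℤ) - γ i ∧ (z.val : ℤ) - γ i < N)})
    (MeasurableSet.of_discrete.nullMeasurableSet)
  exact h.trans_le (zmod_measure_le (γ i))

end Torus

/-! ### Density of the periodic actions. -/

section Periodic

variable {X : Type*} [MeasurableSpace X] {μ : Measure X} {d : ℕ}

/-- The skew product over a translation of `(ℤ/N)^d`: an action along the coboundary
`[y + γ] - [y]`. -/
def periodicMap (T : ZdAction d μ) (N : ℕ) [NeZero N] (γ : Fin d → ℤ) :
    ((Fin d → ZMod N) × X) ≃ᵐ ((Fin d → ZMod N) × X) where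
  toFun z := (z.1 + torusProj N γ, (T.transf (torusCocycle γ z.1)).rep z.2)
  invFun z := (z.1 - torusProj N γ,
    (T.transf (torusCocycle γ (z.1 - torusProj N γ))).rep.symm z.2)
  left_inv z := by simp
  right_inv z := by simp
  measurable_toFun := measurable_from_prod_countable_right fun y =>
    (measurable_const (a := y + torusProj N γ)).prodMk
      (T.transf (torusCocycle γ y)).rep_mp.measurable
  measurable_invFun := measurable_from_prod_countable_right fun y =>
    (measurable_const (a := y - torusProj N γ)).prodMk
      (T.transf (torusCocycle γ (y - torusProj N γ))).rep_symm_mp.measurable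

theorem periodicMap_apply (T : ZdAction d μ) {N : ℕ} [NeZero N] (γ : Fin d → ℤ)
    (z : (Fin d → ZMod N) × X) : periodicMap T N γ z =
      (z.1 + torusProj N γ, (T.transf (torusCocycle γ z.1)).rep z.2) := rfl

theorem periodicMap_symm_apply (T : ZdAction d μ) {N : ℕ} [NeZero N] (γ : Fin d → ℤ)
    (z : (Fin d → ZMod N) × X) : (periodicMap T N γ).symm z =
      (z.1 - torusProj N γ,
        (T.transf (torusCocycle γ (z.1 - torusProj N γ))).rep.symm z.2) := rfl

theorem measurePreserving_periodicMap [SFinite μ] (T : ZdAction d μ) {N : ℕ} [NeZero N]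
    (γ : Fin d → ℤ) : MeasurePreserving (periodicMap T N γ) ((torusMeasure d N).prod μ)
      ((torusMeasure d N).prod μ) :=
  MeasurePreserving.skew_product
    (g := fun y x => (T.transf (torusCocycle γ y)).rep x)
    (measurePreserving_add_right (torusMeasure d N) (torusProj N γ))
    (measurable_from_prod_countable_right fun y =>
      (T.transf (torusCocycle γ y)).rep_mp.measurable)
    (Eventually.of_forall fun y => (T.transf (torusCocycle γ y)).rep_mp.map_eq)

theorem ZdAction.transf_add (T : ZdAction d μ) (γ δ : Fin d → ℤ) :
    T.transf (γ + δ) = T.transf γ * T.transf δ :=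
  map_mul T (Multiplicative.ofAdd γ) (Multiplicative.ofAdd δ)

theorem ZdAction.transf_zero (T : ZdAction d μ) : T.transf 0 = 1 := map_one T

theorem periodicMap_add_ae [SFinite μ] (T : ZdAction d μ) {N : ℕ} [NeZero N]
    (γ δ : Fin d → ℤ) : ∀ᵐ z ∂(torusMeasure d N).prod μ,
      periodicMap T N (γ + δ) z = periodicMap T N γ (periodicMap T N δ z) := by
  -- Representatives compose only almost everywhere, but countably many pairs share one null set, so
  -- the exponents may depend on the base point.
  have h : ∀ᵐ x ∂μ, ∀ α β : Fin d → ℤ,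
      (T.transf (α + β)).rep x = (T.transf α).rep ((T.transf β).rep x) := by
    refine ae_all_iff.2 fun α => ae_all_iff.2 fun β => ?_
    rw [T.transf_add]
    exact Aut.rep_mul _ _
  filter_upwards [Measure.quasiMeasurePreserving_snd.ae h] with z hz
  simp only [periodicMap_apply]
  rw [torusCocycle_add, hz, torusProj_add]
  congr 1
  abel

theorem periodicMap_ae_eq_id [SFinite μ] (T : ZdAction d μ) {N : ℕ} [NeZero N]
    {γ : Fin d → ℤ} (hγ : torusProj N γ = 0) :
    ∀ᵐ z ∂(torusMeasure d N).prod μ, periodicMap T N γ z = z := by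
  have h : ∀ᵐ x ∂μ, (T.transf 0).rep x = x := by
    rw [T.transf_zero]
    exact Aut.rep_one
  filter_upwards [Measure.quasiMeasurePreserving_snd.ae h] with z hz
  have h0 : torusCocycle γ z.1 = 0 := by simp [torusCocycle, hγ]
  rw [periodicMap_apply, h0, hz, hγ, add_zero]

theorem Aut.img_ofMeasurableEquiv (e : X ≃ᵐ X) (he : MeasurePreserving e μ μ) (B : Set X) :
    (Aut.ofMeasurableEquiv e he).img B =ᵐ[μ] e.symm ⁻¹' B := by
  have h := ae_eq_symm_of_ae_eq (f := e.toEquiv) (he.symm e) (Aut.rep_ofMeasurableEquiv e he)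
  filter_upwards [h] with x hx
  exact congrArg (· ∈ B) hx

/-- The conjugate of a transformation of another space by an isomorphism. -/
def Aut.conj {Z : Type*} [MeasurableSpace Z] {ρ : Measure Z} (e : X ≃ᵐ Z)
    (he : MeasurePreserving e μ ρ) (S : Z ≃ᵐ Z) (hS : MeasurePreserving S ρ ρ) : Aut μ :=
  Aut.ofMeasurableEquiv ((e.trans S).trans e.symm) ((he.symm e).comp (hS.comp he))

section Conj

variable {Z : Type*} [MeasurableSpace Z] {ρ : Measure Z} {e : X ≃ᵐ Z}
  {he : MeasurePreserving e μ ρ} {R S S' : Z ≃ᵐ Z} {hR : MeasurePreserving R ρ ρ}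
  {hS : MeasurePreserving S ρ ρ} {hS' : MeasurePreserving S' ρ ρ}

theorem Aut.conj_eq_one (h : ∀ᵐ z ∂ρ, S z = z) : Aut.conj e he S hS = 1 := by
  refine Aut.mk_eq_mk.2 ?_
  filter_upwards [he.quasiMeasurePreserving.ae h] with x hx
  change e.symm (S (e x)) = x
  rw [hx, MeasurableEquiv.symm_apply_apply]

theorem Aut.conj_eq_mul (h : ∀ᵐ z ∂ρ, R z = S (S' z)) :
    Aut.conj e he R hR = Aut.conj e he S hS * Aut.conj e he S' hS' := by
  refine Aut.mk_eq_mk.2 ?_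
  filter_upwards [he.quasiMeasurePreserving.ae h] with x hx
  change e.symm (R (e x)) = e.symm (S (e (e.symm (S' (e x)))))
  rw [hx, MeasurableEquiv.apply_symm_apply]

end Conj

/-- The periodic action that approximates a given action. -/
def periodicAction [SFinite μ] (T : ZdAction d μ) (N : ℕ) [NeZero N]
    (e : X ≃ᵐ (Fin d → ZMod N) × X)
    (he : MeasurePreserving e μ ((torusMeasure d N).prod μ)) : ZdAction d μ where
  toFun γ := Aut.conj e he (periodicMap T N γ.toAdd) (measurePreserving_periodicMap T _)
  map_one' := Aut.conj_eq_one (periodicMap_ae_eq_id T (by ext; simp [torusProj]))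
  map_mul' γ δ := Aut.conj_eq_mul (periodicMap_add_ae T γ.toAdd δ.toAdd)
  continuous_toFun := continuous_of_discreteTopology

theorem periodicAction_transf_eq_one [SFinite μ] (T : ZdAction d μ) {N : ℕ} [NeZero N]
    (e : X ≃ᵐ (Fin d → ZMod N) × X)
    (he : MeasurePreserving e μ ((torusMeasure d N).prod μ)) {γ : Fin d → ℤ}
    (hγ : torusProj N γ = 0) : (periodicAction T N e he).transf γ = 1 :=
  Aut.conj_eq_one (he := he) (hS := measurePreserving_periodicMap T γ) (periodicMap_ae_eq_id T hγ)

/-- By `h1` and `h2`, the isomorphism `e` turns `B` and `T_γ B` into products with the whole torus.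
Over `y` the two images then agree unless the cocycle differs from `γ`, and otherwise the error is
at most `2 * μ B`. -/
theorem measure_symmDiff_periodicAction_le [SFinite μ] (T : ZdAction d μ) {N : ℕ} [NeZero N]
    (e : X ≃ᵐ (Fin d → ZMod N) × X)
    (he : MeasurePreserving e μ ((torusMeasure d N).prod μ)) (γ : Fin d → ℤ) {B : Set X}
    (hB : MeasurableSet B) (h1 : ∀ᵐ x ∂μ, (e x).2 ∈ B ↔ x ∈ B)
    (h2 : ∀ᵐ x ∂μ, (e x).2 ∈ (T.transf γ).img B ↔ x ∈ (T.transf γ).img B) :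
    μ (symmDiff ((T.transf γ).img B) (((periodicAction T N e he).transf γ).img B)) ≤
      2 * μ B * ((N : ℝ≥0∞)⁻¹ * ∑ i, ((γ i).natAbs : ℝ≥0∞)) := by
  let D : Set ((Fin d → ZMod N) × X) := {z | z.2 ∈ symmDiff ((T.transf γ).img B)
    ((T.transf (torusCocycle γ (z.1 - torusProj N γ))).img B)}
  have hD : MeasurableSet D := by
    have : Measurable fun z : (Fin d → ZMod N) × X => z ∈ D :=
      measurable_from_prod_countable_right fun y => measurableSet_setOfPred.1
        (((T.transf γ).measurableSet_img hB).symmDiff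
          ((T.transf (torusCocycle γ (y - torusProj N γ))).measurableSet_img hB))
    exact measurableSet_setOfPred.2 this
  have hDe : μ (symmDiff ((T.transf γ).img B) (((periodicAction T N e he).transf γ).img B)) ≤
      μ (e ⁻¹' D) := by
    refine measure_mono_ae ?_
    have h3 := Aut.img_ofMeasurableEquiv ((e.trans (periodicMap T N γ)).trans e.symm)
      ((he.symm e).comp ((measurePreserving_periodicMap T γ).comp he)) B
    have h4 : ∀ᵐ x ∂μ, x ∈ ((periodicAction T N e he).transf γ).img B ↔
        e.symm ((periodicMap T N γ).symm (e x)) ∈ B := by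
      filter_upwards [h3] with x hx using hx.to_iff
    have h5 : ∀ᵐ z ∂(torusMeasure d N).prod μ, z.2 ∈ B ↔ e.symm z ∈ B := by
      filter_upwards [(he.symm e).quasiMeasurePreserving.ae h1] with z hz
      rwa [MeasurableEquiv.apply_symm_apply] at hz
    have h6 := he.quasiMeasurePreserving.ae
      (((measurePreserving_periodicMap T γ).symm _).quasiMeasurePreserving.ae h5)
    filter_upwards [h2, h4, h6] with x hx2 hx4 hx6 hx
    change (e x).2 ∈ symmDiff ((T.transf γ).img B)
      ((T.transf (torusCocycle γ ((e x).1 - torusProj N γ))).img B)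
    rw [← hx6, periodicMap_symm_apply] at hx4
    change _ ↔ (e x).2 ∈ (T.transf (torusCocycle γ ((e x).1 - torusProj N γ))).img B at hx4
    rcases hx with ⟨ha, hb⟩ | ⟨ha, hb⟩
    · exact Or.inl ⟨hx2.2 ha, fun h => hb (hx4.2 h)⟩
    · exact Or.inr ⟨hx4.1 ha, fun h => hb (hx2.1 h)⟩
  refine hDe.trans ?_
  rw [he.measure_preimage hD.nullMeasurableSet, Measure.prod_apply hD]
  have hle : ∀ y, μ (Prod.mk y ⁻¹' D) ≤
      {y : Fin d → ZMod N | torusCocycle γ (y - torusProj N γ) ≠ γ}.indicator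
        (fun _ => 2 * μ B) y := by
    intro y
    by_cases hy : torusCocycle γ (y - torusProj N γ) = γ
    · have : Prod.mk y ⁻¹' D = ∅ := by
        ext x
        simp [D, hy]
      simp [this]
    · rw [indicator_of_mem (by exact hy)]
      refine (measure_mono (t := (T.transf γ).img B ∪
        (T.transf (torusCocycle γ (y - torusProj N γ))).img B) ?_).trans ?_
      · exact fun x hx => symmDiff_subset_union hx
      · refine (measure_union_le _ _).trans ?_
        rw [Aut.measure_img _ hB, Aut.measure_img _ hB, two_mul]
  refine (lintegral_mono hle).trans ?_
  rw [lintegral_indicator_const MeasurableSet.of_discrete]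
  gcongr
  exact torusMeasure_cocycle_ne_le γ

theorem ZdAction.tendsto_iff {ι : Type*} {l : Filter ι} {u : ι → ZdAction d μ}
    {T : ZdAction d μ} :
    Tendsto u l (𝓝 T) ↔ ∀ γ, Tendsto (fun i => (u i).transf γ) l (𝓝 (T.transf γ)) := by
  have h : IsInducing (fun (S : ZdAction d μ) (γ : Multiplicative (Fin d → ℤ)) => S γ) :=
    ContinuousMap.isHomeomorph_coe.isEmbedding.isInducing.comp
      (ContinuousMonoidHom.isInducing_toContinuousMap _ _)
  rw [h.tendsto_nhds_iff, tendsto_pi_nhds]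
  rfl

/-- Every action is a limit of actions that factor through finite quotients `(ℤ/N)^d`. -/
theorem exists_periodic_tendsto [StandardBorelSpace X] [SigmaFinite μ] [NullSingletonClass μ]
    (hμ : μ ≠ 0) (T : ZdAction d μ) :
    ∃ S : ℕ → ZdAction d μ, Tendsto S atTop (𝓝 T) ∧
      ∀ k (γ : Fin d → ℤ), (S k).transf (((k + 1 : ℕ) : ℤ) • γ) = 1 := by
  obtain ⟨A, hA⟩ := exists_denseSeparating μ
  -- The estimate needs `e` to respect both `A n` and its image, so the images join the family.
  let F : Set (Set X) := range A ∪ range fun q : (Fin d → ℤ) × ℕ => (T.transf q.1).img (A q.2)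
  have hF : F.Countable := (countable_range _).union (countable_range _)
  obtain ⟨C, hC⟩ := hF.exists_eq_range ⟨_, Or.inl ⟨0, rfl⟩⟩
  have hCm : ∀ n, MeasurableSet (C n) := fun n => by
    rcases (hC ▸ mem_range_self n : C n ∈ F) with ⟨m, hm⟩ | ⟨q, hq⟩
    · exact hm ▸ hA.meas m
    · exact hq ▸ (T.transf q.1).measurableSet_img (hA.meas q.2)
  have hiso : ∀ k : ℕ, ∃ e : X ≃ᵐ (Fin d → ZMod (k + 1)) × X,
      MeasurePreserving e μ ((torusMeasure d (k + 1)).prod μ) ∧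
        ∀ m < k, ∀ᵐ x ∂μ, (e x).2 ∈ C m ↔ x ∈ C m := by
    intro k
    obtain ⟨p, hp, hpf, hpC⟩ := exists_partition (μ := μ) hCm k
    obtain ⟨e, he, hep⟩ := exists_measurableEquiv_prod hμ (torusMeasure d (k + 1)) hp hpf
    refine ⟨e, he, fun m hm => ?_⟩
    obtain ⟨J, hJ⟩ := hpC m hm
    filter_upwards [hep] with x hx
    rw [hJ, mem_preimage, mem_preimage, hx]
  choose e he heC using hiso
  refine ⟨fun k => periodicAction T (k + 1) (e k) (he k), ?_, fun k γ => ?_⟩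
  · refine ZdAction.tendsto_iff.2 fun γ => hA.tendsto fun n => ?_
    obtain ⟨m₁, hm₁⟩ : A n ∈ range C := hC ▸ Or.inl ⟨n, rfl⟩
    obtain ⟨m₂, hm₂⟩ : (T.transf γ).img (A n) ∈ range C := hC ▸ Or.inr ⟨(γ, n), rfl⟩
    have hlim : Tendsto (fun k : ℕ => 2 * μ (A n) *
        (((k + 1 : ℕ) : ℝ≥0∞)⁻¹ * ∑ i, ((γ i).natAbs : ℝ≥0∞))) atTop (𝓝 0) := by
      have h1 : Tendsto (fun k : ℕ => ((k + 1 : ℕ) : ℝ≥0∞)⁻¹) atTop (𝓝 0) :=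
        ENNReal.tendsto_inv_nat_nhds_zero.comp (tendsto_add_atTop_nat 1)
      have h2 := ENNReal.Tendsto.mul_const (b := ∑ i, ((γ i).natAbs : ℝ≥0∞)) h1
        (Or.inr (ENNReal.sum_ne_top.2 fun i _ => ENNReal.natCast_ne_top _))
      have h3 := ENNReal.Tendsto.const_mul (a := 2 * μ (A n)) h2
        (Or.inr (ENNReal.mul_ne_top (by simp) (hA.fin n)))
      simpa using h3
    refine tendsto_of_tendsto_of_tendsto_of_le_of_le' tendsto_const_nhds hlim
      (Eventually.of_forall fun _ => zero_le) ?_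
    filter_upwards [eventually_gt_atTop m₁, eventually_gt_atTop m₂] with k hk₁ hk₂
    exact measure_symmDiff_periodicAction_le T (e k) (he k) γ (hA.meas n)
      (by simpa only [hm₁] using heC k m₁ hk₁) (by simpa only [hm₂] using heC k m₂ hk₂)
  · refine periodicAction_transf_eq_one T (e k) (he k) (funext fun i => ?_)
    have h : ((((k + 1 : ℕ) : ℤ) * γ i : ℤ) : ZMod (k + 1)) = 0 := by
      rw [Int.cast_mul, Int.cast_natCast, ZMod.natCast_self, zero_mul]
    exact h

end Periodic

/-! ### Simultaneous approximation of all lines by lattice points. -/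

section Dirichlet

theorem EuclideanSpace.dist_lt_of_forall_abs_le {d : ℕ} {x y : EuclideanSpace ℝ (Fin d)}
    {ε η : ℝ} (hε : 0 < ε) (h : ∀ i, |x i - y i| ≤ η) (hη : (d : ℝ) * η ^ 2 < ε ^ 2) :
    dist x y < ε := by
  rw [EuclideanSpace.dist_eq, Real.sqrt_lt' hε]
  refine lt_of_le_of_lt ?_ hη
  calc ∑ i, dist (x i) (y i) ^ 2 ≤ ∑ _i : Fin d, η ^ 2 := by
        refine Finset.sum_le_sum fun i _ => ?_
        rw [Real.dist_eq]
        exact pow_le_pow_left₀ (abs_nonneg _) (h i) 2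
    _ = d * η ^ 2 := by simp

/-- Two of the first `M ^ d + 1` multiples of a vector are close modulo the integer lattice. -/
theorem exists_lt_forall_abs_fract_sub_le {d : ℕ} (v : Fin d → ℝ) {M : ℕ} (hM : 0 < M) :
    ∃ j k : ℕ, j < k ∧ k ≤ M ^ d ∧
      ∀ i, |Int.fract (2 * (k : ℝ) * v i) - Int.fract (2 * (j : ℝ) * v i)| ≤ (M : ℝ)⁻¹ := by
  have hM' : (0 : ℝ) < M := Nat.cast_pos.2 hM
  have hbox : ∀ x : ℝ, ⌊(M : ℝ) * Int.fract x⌋₊ < M := fun x => by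
    rw [Nat.floor_lt (by positivity)]
    exact mul_lt_of_lt_one_right hM' (Int.fract_lt_one x)
  let b : Fin (M ^ d + 1) → Fin d → Fin M := fun j i =>
    ⟨⌊(M : ℝ) * Int.fract (2 * (j : ℝ) * v i)⌋₊, hbox _⟩
  obtain ⟨j, k, hjk, hb⟩ := Fintype.exists_ne_map_eq_of_card_lt b (by simp)
  have hclose : ∀ i, |Int.fract (2 * (k : ℝ) * v i) - Int.fract (2 * (j : ℝ) * v i)| ≤
      (M : ℝ)⁻¹ := by
    intro i
    have h1 : ⌊(M : ℝ) * Int.fract (2 * (j : ℝ) * v i)⌋₊ =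
        ⌊(M : ℝ) * Int.fract (2 * (k : ℝ) * v i)⌋₊ := congrArg Fin.val (congrFun hb i)
    have h2 := Nat.floor_le (mul_nonneg hM'.le (Int.fract_nonneg (2 * (j : ℝ) * v i)))
    have h3 := Nat.floor_le (mul_nonneg hM'.le (Int.fract_nonneg (2 * (k : ℝ) * v i)))
    have h4 := Nat.lt_floor_add_one ((M : ℝ) * Int.fract (2 * (j : ℝ) * v i))
    have h5 := Nat.lt_floor_add_one ((M : ℝ) * Int.fract (2 * (k : ℝ) * v i))
    rw [h1] at h2 h4
    rw [← one_div, le_div_iff₀ hM', ← abs_of_pos hM', ← abs_mul, abs_le]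
    constructor <;> linarith
  rcases lt_or_gt_of_ne hjk with h | h
  · exact ⟨j, k, h, Nat.lt_succ_iff.1 k.2, hclose⟩
  · exact ⟨k, j, h, Nat.lt_succ_iff.1 j.2, fun i => by rw [abs_sub_comm]; exact hclose i⟩

/-- For every `N` there are finitely many nonzero points of the lattice `N ℤ^d` such that every
line through the origin passes close to one of them. -/
theorem exists_finset_near_lines (d : ℕ) {N : ℕ} (hN : 0 < N) {ε : ℝ} (hε : 0 < ε) :
    ∃ Γ : Finset (Fin d → ℤ), (∀ γ ∈ Γ, γ ≠ 0 ∧ ∃ δ : Fin d → ℤ, γ = (N : ℤ) • δ) ∧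
      ∀ θ : ℙ ℝ (EuclideanSpace ℝ (Fin d)), ∃ γ ∈ Γ, ∃ g ∈ θ.submodule,
        dist (latticePoint γ) g < ε := by
  classical
  wlog hε1 : ε ≤ 1 generalizing ε
  · obtain ⟨Γ, h1, h2⟩ := this one_pos le_rfl
    refine ⟨Γ, h1, fun θ => ?_⟩
    obtain ⟨γ, hγ, g, hg, h⟩ := h2 θ
    exact ⟨γ, hγ, g, hg, h.trans (not_le.1 hε1)⟩
  have hN' : (0 : ℝ) < N := Nat.cast_pos.2 hN
  -- Each coordinate error will be at most `N / M`; the factor `d + 1` makes the Euclidean error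
  -- less than `ε`, also for `d = 0`.
  obtain ⟨M, hM⟩ := exists_nat_gt ((d + 1 : ℝ) * N / ε)
  have hM' : (0 : ℝ) < M := lt_trans (by positivity) hM
  have hMpos : 0 < M := Nat.cast_pos.1 hM'
  have hη : (d : ℝ) * (N * (M : ℝ)⁻¹) ^ 2 < ε ^ 2 := by
    have h1 : (d + 1 : ℝ) * (N * (M : ℝ)⁻¹) < ε := by
      rw [div_lt_iff₀ hε] at hM
      rw [← mul_assoc, ← div_eq_mul_inv, div_lt_iff₀ hM']
      linarith
    have h2 : ((d + 1 : ℝ) * (N * (M : ℝ)⁻¹)) ^ 2 < ε ^ 2 :=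
      pow_lt_pow_left₀ h1 (by positivity) two_ne_zero
    refine lt_of_le_of_lt ?_ h2
    rw [mul_pow (d + 1 : ℝ)]
    exact mul_le_mul_of_nonneg_right (by nlinarith [(Nat.cast_nonneg d : (0 : ℝ) ≤ d)])
      (sq_nonneg _)
  -- A bound for the floors that does not depend on the line, since unit vectors have coordinates at
  -- most `1`. Each `δ i` is a difference of two floors, hence the box of radius `2 * K`.
  let K : ℤ := 2 * M ^ d
  refine ⟨((Fintype.piFinset fun _ : Fin d => Finset.Icc (-(2 * K)) (2 * K)).image
    fun δ => (N : ℤ) • δ).filter (· ≠ 0), fun γ hγ => ?_, fun θ => ?_⟩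
  · rw [Finset.mem_filter, Finset.mem_image] at hγ
    obtain ⟨⟨δ, -, rfl⟩, h⟩ := hγ
    exact ⟨h, δ, rfl⟩
  have hrep := θ.rep_nonzero
  let v : EuclideanSpace ℝ (Fin d) := ‖θ.rep‖⁻¹ • θ.rep
  have hv : ‖v‖ = 1 := norm_smul_inv_norm hrep
  have hvθ : v ∈ θ.submodule := by
    rw [Projectivization.submodule_eq]
    exact Submodule.smul_mem _ _ (Submodule.mem_span_singleton_self _)
  obtain ⟨j, k, hjk, hk, hfract⟩ := exists_lt_forall_abs_fract_sub_le v hMpos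
  let δ : Fin d → ℤ := fun i => ⌊2 * (k : ℝ) * v i⌋ - ⌊2 * (j : ℝ) * v i⌋
  have hfloor : ∀ (m : ℕ), m ≤ M ^ d → ∀ i, |⌊2 * (m : ℝ) * v i⌋| ≤ K := by
    intro m hm i
    have h1 : |v i| ≤ 1 := by
      have := PiLp.norm_apply_le v i
      rwa [hv, Real.norm_eq_abs] at this
    have hmM : (m : ℝ) ≤ (M : ℝ) ^ d := by exact_mod_cast hm
    have h2 : |2 * (m : ℝ) * v i| ≤ 2 * (M : ℝ) ^ d := by
      rw [abs_mul, abs_of_nonneg (by positivity : (0 : ℝ) ≤ 2 * m)]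
      nlinarith [abs_nonneg (v i), (Nat.cast_nonneg m : (0 : ℝ) ≤ m)]
    rw [abs_le] at h2 ⊢
    refine ⟨Int.le_floor.2 ?_, ?_⟩
    · push_cast [K]
      linarith [h2.1]
    · have h3 := (Int.floor_le (2 * (m : ℝ) * v i)).trans h2.2
      have h4 : ((⌊2 * (m : ℝ) * v i⌋ : ℤ) : ℝ) ≤ (K : ℝ) := by push_cast [K]; exact h3
      exact_mod_cast h4
  have hdist : dist (latticePoint ((N : ℤ) • δ)) ((2 * N * ((k : ℝ) - j)) • v) < ε := by
    refine EuclideanSpace.dist_lt_of_forall_abs_le hε (fun i => ?_) hη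
    have h1 : latticePoint ((N : ℤ) • δ) i - ((2 * N * ((k : ℝ) - j)) • v) i =
        -(N * (Int.fract (2 * (k : ℝ) * v i) - Int.fract (2 * (j : ℝ) * v i))) := by
      simp only [latticePoint, δ, Int.fract, PiLp.smul_apply, Pi.smul_apply, smul_eq_mul]
      push_cast
      ring
    rw [h1, abs_neg, abs_mul, abs_of_pos hN']
    exact mul_le_mul_of_nonneg_left (hfract i) hN'.le
  -- The approximated vector has length at least `2 * N`, while the distance is below `ε ≤ 1`.
  have hne : (N : ℤ) • δ ≠ 0 := by
    intro h0
    have h1 : latticePoint (0 : Fin d → ℤ) = 0 := by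
      ext i
      simp [latticePoint]
    have hkj : (1 : ℝ) ≤ (k : ℝ) - j := by
      have : ((j + 1 : ℕ) : ℝ) ≤ k := Nat.cast_le.2 hjk
      push_cast at this
      linarith
    have hN1 : (1 : ℝ) ≤ N := Nat.one_le_cast.2 hN
    rw [h0, h1, dist_zero_left, norm_smul, hv, mul_one, Real.norm_eq_abs,
      abs_of_nonneg (by positivity)] at hdist
    nlinarith
  refine ⟨(N : ℤ) • δ, ?_, _, Submodule.smul_mem _ _ hvθ, hdist⟩
  rw [Finset.mem_filter]
  refine ⟨Finset.mem_image_of_mem _ (Fintype.mem_piFinset.2 fun i => ?_), hne⟩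
  have h1 := abs_le.1 (hfloor k hk i)
  have h2 := abs_le.1 (hfloor j (hjk.le.trans hk) i)
  rw [Finset.mem_Icc]
  constructor <;> simp only [δ] <;> linarith [h1.1, h1.2, h2.1, h2.2]

end Dirichlet

/-! ### The Baire category argument. -/

section Residual

variable {X : Type*} [MeasurableSpace X] {μ : Measure X} {d : ℕ}

/-- The actions for which finitely many nonzero `γ`, close to all lines through the origin,
almost preserve a given set. -/
def nearlyRigid (d : ℕ) (μ : Measure X) (B : Set X) (ε : ℝ) : Set (ZdAction d μ) :=
  {T | ∃ Γ : Finset (Fin d → ℤ),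
    (∀ θ : ℙ ℝ (EuclideanSpace ℝ (Fin d)), ∃ γ ∈ Γ, ∃ g ∈ θ.submodule,
      dist (latticePoint γ) g < ε) ∧
    ∀ γ ∈ Γ, γ ≠ 0 ∧ μ (symmDiff B ((T.transf γ).img B)) < μ B / 4}

theorem isOpen_nearlyRigid {B : Set X} (hB : MeasurableSet B) (hBf : μ B ≠ ∞) (ε : ℝ) :
    IsOpen (nearlyRigid d μ B ε) := by
  refine isOpen_iff_mem_nhds.2 fun T ⟨Γ, hΓ, hT⟩ => ?_
  have h : ∀ᶠ S in 𝓝 T, ∀ γ ∈ Γ, γ ≠ 0 ∧ μ (symmDiff B ((S.transf γ).img B)) < μ B / 4 := by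
    refine (Finset.eventually_all Γ).2 fun γ hγ => ?_
    have hind : IsInducing (fun (T : Aut μ) (p : FiniteSets μ × FiniteSets μ) =>
        T.symmDiffMeasure p.1.1 p.2.1) := ⟨rfl⟩
    have hcont : Continuous fun S : Aut μ => S.symmDiffMeasure B B :=
      continuous_pi_iff.1 hind.continuous (⟨B, hB, hBf.lt_top⟩, ⟨B, hB, hBf.lt_top⟩)
    have h1 := (hcont.tendsto _).comp (ZdAction.tendsto_iff.1 (tendsto_id (x := 𝓝 T)) γ)
    have h2 := h1.eventually_lt_const (u := μ B / 4)
      (by rw [Aut.symmDiffMeasure_eq]; exact (hT γ hγ).2)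
    filter_upwards [h2] with S hS
    refine ⟨(hT γ hγ).1, ?_⟩
    rw [← Aut.symmDiffMeasure_eq]
    exact hS
  filter_upwards [h] with S hS using ⟨Γ, hΓ, hS⟩

theorem dense_nearlyRigid [StandardBorelSpace X] [SigmaFinite μ] [NullSingletonClass μ]
    {B : Set X} (hB0 : μ B ≠ 0) {ε : ℝ} (hε : 0 < ε) : Dense (nearlyRigid d μ B ε) := by
  have hμ : μ ≠ 0 := fun h => hB0 (by simp [h])
  intro T
  obtain ⟨S, hS, hS1⟩ := exists_periodic_tendsto hμ T
  refine mem_closure_of_tendsto hS (Eventually.of_forall fun k => ?_)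
  obtain ⟨Γ, hΓ, hΓθ⟩ := exists_finset_near_lines d k.succ_pos hε
  refine ⟨Γ, hΓθ, fun γ hγ => ⟨(hΓ γ hγ).1, ?_⟩⟩
  obtain ⟨δ, rfl⟩ := (hΓ γ hγ).2
  rw [hS1 k δ]
  have h0 : μ (symmDiff B ((1 : Aut μ).img B)) = 0 :=
    measure_symmDiff_eq_zero_iff.2 (Aut.img_one B).symm
  rw [h0]
  exact ENNReal.div_pos hB0 (by simp)

/-- If `B` and `S B` met in a null set, `B ∆ S B` would have measure at least `μ B`; going through
`A` and `S A` bounds it by `(1/8 + 9/32 + 1/8) * μ B`, that is, `(17/32) * μ B`. -/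
theorem measure_inter_img_pos {S : Aut μ} {A B : Set X} (hA : MeasurableSet A)
    (hB : MeasurableSet B) (hB0 : μ B ≠ 0) (hBf : μ B ≠ ∞) (hAB : μ (symmDiff B A) < μ B / 8)
    (hSA : μ (symmDiff A (S.img A)) < μ A / 4) : 0 < μ (B ∩ S.img B) := by
  by_contra h
  have h0 : μ (B ∩ S.img B) = 0 := by simpa using h
  have h1 : μ B ≤ μ (symmDiff B (S.img B)) := by
    refine (measure_mono fun x hx => ?_).trans
      ((measure_union_le (B ∩ S.img B) (symmDiff B (S.img B))).trans_eq (by rw [h0, zero_add]))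
    by_cases hxS : x ∈ S.img B
    · exact Or.inl ⟨hx, hxS⟩
    · exact Or.inr (Or.inl ⟨hx, hxS⟩)
  have h2 : μ A ≤ μ B + μ B / 8 := by
    refine (measure_le_add_symmDiff A B).trans ?_
    rw [symmDiff_comm]
    gcongr
  have h3 : μ (symmDiff B (S.img B)) ≤ μ B / 8 + ((μ B + μ B / 8) / 4 + μ B / 8) := by
    refine (measure_symmDiff_triangle B A _).trans (add_le_add hAB.le ?_)
    refine (measure_symmDiff_triangle A (S.img A) _).trans (add_le_add ?_ ?_)
    · exact hSA.le.trans (by gcongr)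
    · rw [S.measure_img_symmDiff hA hB, symmDiff_comm]
      exact hAB.le
  have h4 := h1.trans h3
  lift μ B to NNReal using hBf with b
  have hb : 0 < b := pos_iff_ne_zero.2 (by simpa using hB0)
  have h5 : b ≤ b / 8 + ((b + b / 8) / 4 + b / 8) := by
    have h8 : ((b / 8 : NNReal) : ℝ≥0∞) = (b : ℝ≥0∞) / 8 := by
      rw [ENNReal.coe_div (by norm_num)]; rfl
    have h9 : (((b + b / 8) / 4 : NNReal) : ℝ≥0∞) = ((b : ℝ≥0∞) + (b : ℝ≥0∞) / 8) / 4 := by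
      rw [ENNReal.coe_div (by norm_num), ENNReal.coe_add, h8]; rfl
    rw [← ENNReal.coe_le_coe, ENNReal.coe_add, ENNReal.coe_add, h8, h9]
    exact h4
  have h6 : (b : ℝ) ≤ b / 8 + ((b + b / 8) / 4 + b / 8) := by exact_mod_cast h5
  have h7 : (0 : ℝ) < b := by exact_mod_cast hb
  linarith

theorem recurrentDirections_eq_univ_of_mem_nearlyRigid [SigmaFinite μ] {A : ℕ → Set X}
    (hA : DenseSeparating μ A) {T : ZdAction d μ}
    (hT : ∀ n m : ℕ, μ (A n) ≠ 0 → T ∈ nearlyRigid d μ (A n) (1 / (m + 1))) :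
    recurrentDirections T = univ := by
  refine eq_univ_of_forall fun θ ε hε B hB hB0 => ?_
  -- The dense family approximates only sets of finite measure; returns to a subset are returns to
  -- `B`.
  obtain ⟨B', hB', hB'B, hB'0, hB'f⟩ := Measure.exists_subset_measure_lt_top hB hB0
  obtain ⟨n, hn⟩ := hA.dense B' hB' hB'f.ne (μ B' / 8)
    (ENNReal.div_pos hB'0.ne' (by simp)).ne'
  have hn0 : μ (A n) ≠ 0 := by
    intro h0
    have h1 := measure_le_add_symmDiff (μ := μ) B' (A n)
    rw [h0, zero_add] at h1
    refine absurd (h1.trans_lt hn) (not_lt.2 ?_)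
    exact ENNReal.div_le_of_le_mul (le_mul_of_one_le_right zero_le (by norm_num))
  obtain ⟨m, hm⟩ := exists_nat_one_div_lt hε
  obtain ⟨Γ, hΓ, hΓT⟩ := hT n m hn0
  obtain ⟨γ, hγ, g, hg, hγg⟩ := hΓ θ
  refine ⟨γ, (hΓT γ hγ).1, g, hg, hγg.trans hm, ?_⟩
  rw [Aut.interMeasure_eq]
  refine (measure_inter_img_pos (hA.meas n) hB' hB'0.ne' hB'f.ne hn (hΓT γ hγ).2).trans_le ?_
  exact measure_mono (inter_subset_inter hB'B (preimage_mono hB'B))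

theorem recurrent_mem_residual (d : ℕ) [StandardBorelSpace X] [SigmaFinite μ]
    [NullSingletonClass μ] :
    {T : ZdAction d μ | recurrentDirections T = univ} ∈ residual (ZdAction d μ) := by
  obtain ⟨A, hA⟩ := exists_denseSeparating μ
  have h : ∀ᶠ T in residual (ZdAction d μ), ∀ n m : ℕ, μ (A n) ≠ 0 →
      T ∈ nearlyRigid d μ (A n) (1 / (m + 1)) := by
    refine eventually_countable_forall.2 fun n => eventually_countable_forall.2 fun m => ?_
    -- Null sets must be exempted: for them the strict bound `μ B / 4` is zero.
    by_cases h0 : μ (A n) = 0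
    · exact Eventually.of_forall fun T h => absurd h0 h
    · have h1 := residual_of_dense_open (isOpen_nearlyRigid (d := d) (hA.meas n) (hA.fin n)
        (1 / (m + 1))) (dense_nearlyRigid h0 (by positivity))
      filter_upwards [h1] with T hT _ using hT
  filter_upwards [h] with T hT using recurrentDirections_eq_univ_of_mem_nearlyRigid hA hT

end Residual

end DirRec

end

theorem theorem5p6 (d : ℕ) {X : Type*} [MeasurableSpace X] [StandardBorelSpace X]
    (μ : MeasureTheory.Measure X) [MeasureTheory.SigmaFinite μ]
    [MeasureTheory.NullSingletonClass μ] (hμ : μ Set.univ = ⊤) :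
    PolishSpace (DirRec.ZdAction d μ) ∧
      {T : DirRec.ZdAction d μ | DirRec.recurrentDirections T = Set.univ} ∈
        residual (DirRec.ZdAction d μ) :=
  ⟨DirRec.ZdAction.polishSpace d fun h => by simp [h] at hμ, DirRec.recurrent_mem_residual d⟩
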